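/- Let $G=(J,M,E)$ be a bipartite graph between a set $J$ of $n\ge 1$ jobs and a set $M$ of machines, and let $p_{i,j}>0$ be the (real) processing time of job $j$ on machine $i$, for every $(j,i)\in E$. Let $\epsilon\in(0,1]$, and let $x\in\mathbb{R}_{\ge 0}^{E}$ be a fractional assignment, that is, $\sum_{i:(j,i)\in E}x_{j,i}=1$ for every $j\in J$. There is a deterministic algorithm on the unit-cost real RAM (exact real arithmetic $+,-,\times,/$ and comparisons, with no rounding of real numbers to integers; array memory, initially $0$ outside the input; integer addition, truncated subtraction and comparison) which, given $G$ as a list of its edges in any order together with $p$, $x$ and $\epsilon$, halts after $O\!\left(\frac{|E|}{\epsilon}\log (n+1)\right)$ steps, with an absolute constant in the $O(\cdot)$, and outputs an assignment $\sigma:J\to M$ such that $(j,\sigma(j))\in E$ and $x_{j,\sigma(j)}>0$ for every $j\in J$, and such that for every machine $i\in M$ $$\sum_{j\in\sigma^{-1}(i)}p_{i,j}\;\le\;\max_{j\in\sigma^{-1}(i)}p_{i,j}\;+\;(1+\epsilon)\sum_{j:(j,i)\in E}p_{i,j}\,x_{j,i},$$ where the maximum over the empty set is $0$. -/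

import Mathlib

/-!
# A unit-cost real random access machine, and rounding for unrelated machine scheduling
-/

namespace RealRAM

/-- The memory of the machine: countably many arrays of natural numbers (indices, pointers and
counters) and countably many arrays of exact real numbers. The entry `k` of the array with the
constant name `a` is `nat a k`, respectively `real a k`. A program is a finite text, so it mentions
only finitely many array names. -/
structure Memory where
  nat : ℕ → ℕ → ℕ
  real : ℕ → ℕ → ℝ

/-- Expressions for natural numbers: constants, array access with a computed address
(indirect addressing is obtained by nesting), addition and truncated subtraction. -/
inductive NatExpr where
  | const (c : ℕ) : NatExpr
  | get (a : ℕ) (k : NatExpr) : NatExpr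
  | add (e f : NatExpr) : NatExpr
  | sub (e f : NatExpr) : NatExpr

/-- Expressions for real numbers: rational constants, array access with a computed address, and the
four field operations (`x / 0 = 0`). There is no rounding and no conversion from real numbers
to natural numbers. -/
inductive RealExpr where
  | const (c : ℚ) : RealExpr
  | get (a : ℕ) (k : NatExpr) : RealExpr
  | add (e f : RealExpr) : RealExpr
  | sub (e f : RealExpr) : RealExpr
  | mul (e f : RealExpr) : RealExpr
  | div (e f : RealExpr) : RealExpr

/-- Tests: comparison of two natural numbers or of two real numbers. -/
inductive Test where
  | natLE (e f : NatExpr) : Test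
  | realLE (e f : RealExpr) : Test

/-- Programs: assignments to array entries with computed addresses, combined by sequential
composition, branching and loops. -/
inductive Program where
  | skip : Program
  | setNat (a : ℕ) (k : NatExpr) (v : NatExpr) : Program
  | setReal (a : ℕ) (k : NatExpr) (v : RealExpr) : Program
  | seq (P Q : Program) : Program
  | branch (b : Test) (P Q : Program) : Program
  | loop (b : Test) (P : Program) : Program

/-- The value of a natural number expression. -/
def NatExpr.eval (s : Memory) : NatExpr → ℕ
  | const c => c
  | get a k => s.nat a (k.eval s)
  | add e f => e.eval s + f.eval s
  | sub e f => e.eval s - f.eval s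

/-- The number of unit-cost operations in a natural number expression. -/
def NatExpr.cost : NatExpr → ℕ
  | const _ => 1
  | get _ k => k.cost + 1
  | add e f => e.cost + f.cost + 1
  | sub e f => e.cost + f.cost + 1

/-- The value of a real number expression. -/
noncomputable def RealExpr.eval (s : Memory) : RealExpr → ℝ
  | const c => (c : ℝ)
  | get a k => s.real a (k.eval s)
  | add e f => e.eval s + f.eval s
  | sub e f => e.eval s - f.eval s
  | mul e f => e.eval s * f.eval s
  | div e f => e.eval s / f.eval s

/-- The number of unit-cost operations in a real number expression. -/
def RealExpr.cost : RealExpr → ℕ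
  | const _ => 1
  | get _ k => k.cost + 1
  | add e f => e.cost + f.cost + 1
  | sub e f => e.cost + f.cost + 1
  | mul e f => e.cost + f.cost + 1
  | div e f => e.cost + f.cost + 1

/-- The truth of a test. -/
def Test.Holds (s : Memory) : Test → Prop
  | natLE e f => e.eval s ≤ f.eval s
  | realLE e f => e.eval s ≤ f.eval s

/-- The number of unit-cost operations in a test. -/
def Test.cost : Test → ℕ
  | natLE e f => e.cost + f.cost + 1
  | realLE e f => e.cost + f.cost + 1

/-- The memory after the entry `k` of the natural number array `a` is overwritten with `v`. -/
def Memory.writeNat (s : Memory) (a k v : ℕ) : Memory where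
  nat := fun b l => if b = a ∧ l = k then v else s.nat b l
  real := s.real

/-- The memory after the entry `k` of the real number array `a` is overwritten with `v`. -/
noncomputable def Memory.writeReal (s : Memory) (a k : ℕ) (v : ℝ) : Memory where
  nat := s.nat
  real := fun b l => if b = a ∧ l = k then v else s.real b l

/-- `Runs P s t s'`: the program `P`, started with the memory `s`, halts after exactly `t` steps
with the memory `s'`. Every executed assignment, test and elementary operation is counted. -/
inductive Runs : Program → Memory → ℕ → Memory → Prop
  | skip (s : Memory) : Runs .skip s 1 s
  | setNat (a : ℕ) (k v : NatExpr) (s : Memory) :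
      Runs (.setNat a k v) s (k.cost + v.cost + 1) (s.writeNat a (k.eval s) (v.eval s))
  | setReal (a : ℕ) (k : NatExpr) (v : RealExpr) (s : Memory) :
      Runs (.setReal a k v) s (k.cost + v.cost + 1) (s.writeReal a (k.eval s) (v.eval s))
  | seq {P Q : Program} {s s' s'' : Memory} {t t' : ℕ} :
      Runs P s t s' → Runs Q s' t' s'' → Runs (.seq P Q) s (t + t') s''
  | branch_true {b : Test} {P Q : Program} {s s' : Memory} {t : ℕ} :
      b.Holds s → Runs P s t s' → Runs (.branch b P Q) s (b.cost + t) s'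
  | branch_false {b : Test} {P Q : Program} {s s' : Memory} {t : ℕ} :
      ¬ b.Holds s → Runs Q s t s' → Runs (.branch b P Q) s (b.cost + t) s'
  | loop_done {b : Test} {P : Program} {s : Memory} :
      ¬ b.Holds s → Runs (.loop b P) s b.cost s
  | loop_step {b : Test} {P : Program} {s s' s'' : Memory} {t t' : ℕ} :
      b.Holds s → Runs P s t s' → Runs (.loop b P) s' t' s'' →
        Runs (.loop b P) s (b.cost + t + t') s''

end RealRAM

namespace UnrelatedMachines

/-- `x` is a fractional assignment on the bipartite graph with edge set `E`: it is nonnegative on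
the edges, and every job is assigned to a total extent of `1`. -/
def IsFractionalAssignment {n m : ℕ} (E : Finset (Fin n × Fin m)) (x : Fin n → Fin m → ℝ) : Prop :=
  (∀ j i, (j, i) ∈ E → 0 ≤ x j i) ∧
    ∀ j, ∑ i ∈ Finset.univ.filter (fun i => (j, i) ∈ E), x j i = 1

/-- The set of the jobs that `σ` assigns to the machine `i`. -/
def jobsOn {n m : ℕ} (σ : Fin n → Fin m) (i : Fin m) : Finset (Fin n) :=
  Finset.univ.filter (fun j => σ j = i)

/-- The load of the machine `i` under the assignment `σ`. -/
noncomputable def load {n m : ℕ} (p : Fin m → Fin n → ℝ) (σ : Fin n → Fin m) (i : Fin m) : ℝ :=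
  ∑ j ∈ jobsOn σ i, p i j

/-- The largest processing time of a job that `σ` assigns to the machine `i`;
it is `0` if there is no such job. -/
noncomputable def maxJob {n m : ℕ} (p : Fin m → Fin n → ℝ) (σ : Fin n → Fin m) (i : Fin m) : ℝ :=
  if h : (jobsOn σ i).Nonempty then (jobsOn σ i).sup' h (p i) else 0

/-- The load of the machine `i` under the fractional assignment `x`. -/
noncomputable def fractionalLoad {n m : ℕ} (E : Finset (Fin n × Fin m)) (p : Fin m → Fin n → ℝ)
    (x : Fin n → Fin m → ℝ) (i : Fin m) : ℝ :=
  ∑ j ∈ Finset.univ.filter (fun j => (j, i) ∈ E), p i j * x j i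

/-- The memory at the start of the computation. The edges are listed in the order given by `edge`.
Natural numbers: array `0` holds `n`, `m`, `|E|`; arrays `1` and `2` hold the job and the machine of
each edge. Real numbers: array `0` holds `ε`; arrays `1` and `2` hold the processing time and
the fractional value of each edge. All other entries are `0`. -/
noncomputable def input {n m : ℕ} (E : Finset (Fin n × Fin m)) (edge : Fin E.card ≃ {e // e ∈ E})
    (p : Fin m → Fin n → ℝ) (x : Fin n → Fin m → ℝ) (ε : ℝ) : RealRAM.Memory where
  nat := fun a k =>
    match a with
    | 0 => if k = 0 then n else if k = 1 then m else if k = 2 then E.card else 0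
    | 1 => if h : k < E.card then ((edge ⟨k, h⟩).1.1 : ℕ) else 0
    | 2 => if h : k < E.card then ((edge ⟨k, h⟩).1.2 : ℕ) else 0
    | _ => 0
  real := fun a k =>
    match a with
    | 0 => if k = 0 then ε else 0
    | 1 => if h : k < E.card then p (edge ⟨k, h⟩).1.2 (edge ⟨k, h⟩).1.1 else 0
    | 2 => if h : k < E.card then x (edge ⟨k, h⟩).1.1 (edge ⟨k, h⟩).1.2 else 0
    | _ => 0

/-- The memory `s` holds the assignment `σ` in the natural number array `3`. -/
def IsOutput {n m : ℕ} (s : RealRAM.Memory) (σ : Fin n → Fin m) : Prop :=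
  ∀ j : Fin n, s.nat 3 j = (σ j : ℕ)

end UnrelatedMachines

/-! ### Timed reasoning about programs of the real random access machine -/

namespace RealRAM

/-! Every machine gets a row of slots of capacity 1. Its edges of positive weight, in order of
decreasing processing time, are poured with the weights `(1 + ε) * x` into these slots one after the
other; an edge is split where a slot becomes full. Suppose that the jobs occupy pairwise different
slots, each through a piece of one of its own edges. Then the load bound holds (`EdgeList.load_le`):
the job in the first slot of a machine costs at most the maximum, and a job in a later slot is no
longer than any piece in the preceding slot. That slot has total weight exactly 1, so the job costs
at most its weighted sum of processing times. These sums add up to at most `1 + ε` times the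
fractional load.

Such a placement is found by labels. Every job has total weight `1 + ε` and every slot at most 1, so
a set `S` of jobs meets at least `(1 + ε) * |S|` slots. A job without a slot takes an adjacent slot
whose level is below its label, raises the level to the label and evicts the occupant; if there is
no such slot, its label grows by 1. All slots adjacent to a job of label at least `i + 1` have level
at least `i`, so for `i ≥ 1` they are occupied by different jobs of label at least `i`. Hence the
number of jobs of label at least `i` shrinks by a factor `1 + ε` with each `i`
(`Matching.expansion`), and no label exceeds `L` if `n < (1 + ε) ^ L` (`Matching.label_le`). Neither
Hall's theorem nor augmenting paths are needed: termination of the process produces the placement.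

For the running time, a machine has at most `n` edges, so heap sort costs `O(log (n + 1))` per edge
(`heapSort_ends`); pouring creates at most six pieces per edge (`emit_ends`); and each increase of a
label pays for one scan of the pieces of the job (`matchJobs_ends`). The exponents `K` and `L` are
`O(log (n + 1))` and `O(log (n + 1) / ε)` (`exists_exponents`). All loops are bounded by potentials
through `Ends.loop`. -/

theorem Memory.writeNat_nat (s : Memory) (a k v b : ℕ) :
    (s.writeNat a k v).nat b = if b = a then Function.update (s.nat a) k v else s.nat b := by
  funext l
  by_cases hb : b = a
  · subst hb
    simp [Memory.writeNat, Function.update_apply]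
  · simp [Memory.writeNat, hb]

theorem Memory.writeNat_real (s : Memory) (a k v : ℕ) : (s.writeNat a k v).real = s.real := rfl

theorem Memory.writeReal_nat (s : Memory) (a k : ℕ) (v : ℝ) :
    (s.writeReal a k v).nat = s.nat := rfl

theorem Memory.writeReal_real (s : Memory) (a k : ℕ) (v : ℝ) (b : ℕ) :
    (s.writeReal a k v).real b =
      if b = a then Function.update (s.real a) k v else s.real b := by
  funext l
  by_cases hb : b = a
  · subst hb
    simp [Memory.writeReal, Function.update_apply]
  · simp [Memory.writeReal, hb]

/-- The entry `0` of the array `a`, used as a scalar variable. -/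
abbrev NatExpr.var (a : ℕ) : NatExpr := .get a (.const 0)

/-- The entry `0` of the array `a`, used as a scalar variable. -/
abbrev RealExpr.var (a : ℕ) : RealExpr := .get a (.const 0)

/-- A program without loops. -/
def Program.LoopFree : Program → Prop
  | .skip => True
  | .setNat _ _ _ => True
  | .setReal _ _ _ => True
  | .seq P Q => P.LoopFree ∧ Q.LoopFree
  | .branch _ P Q => P.LoopFree ∧ Q.LoopFree
  | .loop _ _ => False

open Classical in
/-- The memory after the execution of a program without loops. -/
noncomputable def Program.run : Program → Memory → Memory
  | .skip, s => s
  | .setNat a k v, s => s.writeNat a (k.eval s) (v.eval s)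
  | .setReal a k v, s => s.writeReal a (k.eval s) (v.eval s)
  | .seq P Q, s => Q.run (P.run s)
  | .branch b P Q, s => if b.Holds s then P.run s else Q.run s
  | .loop _ _, s => s

/-- An upper bound for the running time of a program without loops. -/
def Program.maxCost : Program → ℕ
  | .skip => 1
  | .setNat _ k v => k.cost + v.cost + 1
  | .setReal _ k v => k.cost + v.cost + 1
  | .seq P Q => P.maxCost + Q.maxCost
  | .branch b P Q => b.cost + (P.maxCost + Q.maxCost)
  | .loop b _ => b.cost

theorem Program.LoopFree.runs {P : Program} (h : P.LoopFree) (s : Memory) :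
    ∃ t ≤ P.maxCost, Runs P s t (P.run s) := by
  induction P generalizing s with
  | skip => exact ⟨1, le_rfl, .skip s⟩
  | setNat a k v => exact ⟨_, le_rfl, .setNat a k v s⟩
  | setReal a k v => exact ⟨_, le_rfl, .setReal a k v s⟩
  | seq P Q ihP ihQ =>
    obtain ⟨t, ht, hr⟩ := ihP h.1 s
    obtain ⟨t', ht', hr'⟩ := ihQ h.2 (P.run s)
    exact ⟨t + t', by simp only [maxCost]; omega, .seq hr hr'⟩
  | branch b P Q ihP ihQ =>
    by_cases hb : b.Holds s
    · obtain ⟨t, ht, hr⟩ := ihP h.1 s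
      refine ⟨b.cost + t, by simp only [maxCost]; omega, ?_⟩
      simpa only [run, if_pos hb] using Runs.branch_true hb hr
    · obtain ⟨t, ht, hr⟩ := ihQ h.2 s
      refine ⟨b.cost + t, by simp only [maxCost]; omega, ?_⟩
      simpa only [run, if_neg hb] using Runs.branch_false hb hr
  | loop b P => exact h.elim

/-- The names of the natural number arrays that a program may change. -/
def Program.natWrites : Program → List ℕ
  | .skip => []
  | .setNat a _ _ => [a]
  | .setReal _ _ _ => []
  | .seq P Q => P.natWrites ++ Q.natWrites
  | .branch _ P Q => P.natWrites ++ Q.natWrites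
  | .loop _ P => P.natWrites

/-- The names of the real number arrays that a program may change. -/
def Program.realWrites : Program → List ℕ
  | .skip => []
  | .setNat _ _ _ => []
  | .setReal a _ _ => [a]
  | .seq P Q => P.realWrites ++ Q.realWrites
  | .branch _ P Q => P.realWrites ++ Q.realWrites
  | .loop _ P => P.realWrites

/-- The memories `s` and `s'` agree on the arrays that `P` does not change. -/
structure Frame (P : Program) (s s' : Memory) : Prop where
  nat : ∀ a, a ∉ P.natWrites → s'.nat a = s.nat a
  real : ∀ a, a ∉ P.realWrites → s'.real a = s.real a

theorem Frame.refl (P : Program) (s : Memory) : Frame P s s := ⟨fun _ _ => rfl, fun _ _ => rfl⟩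

theorem Frame.trans {P : Program} {s s' s'' : Memory} (h : Frame P s s') (h' : Frame P s' s'') :
    Frame P s s'' :=
  ⟨fun a ha => (h'.nat a ha).trans (h.nat a ha), fun a ha => (h'.real a ha).trans (h.real a ha)⟩

theorem Frame.mono {P Q : Program} {s s' : Memory} (h : Frame P s s')
    (hn : P.natWrites ⊆ Q.natWrites) (hr : P.realWrites ⊆ Q.realWrites) : Frame Q s s' :=
  ⟨fun a ha => h.nat a fun h => ha (hn h), fun a ha => h.real a fun h => ha (hr h)⟩

/-- The arrays that may change are read off the program text. Preservation of the others then
reduces to a check on a list of array names, and a loop invariant has to mention only what changes.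
-/
theorem Runs.frame {P : Program} {s s' : Memory} {t : ℕ} (h : Runs P s t s') : Frame P s s' := by
  induction h with
  | skip s => exact .refl _ _
  | setNat a k v s =>
    refine ⟨fun b hb => ?_, fun b _ => rfl⟩
    rw [Memory.writeNat_nat, if_neg (by simpa [Program.natWrites] using hb)]
  | setReal a k v s =>
    refine ⟨fun b _ => rfl, fun b hb => ?_⟩
    rw [Memory.writeReal_real, if_neg (by simpa [Program.realWrites] using hb)]
  | seq _ _ ih ih' =>
    exact (ih.mono (List.subset_append_left _ _) (List.subset_append_left _ _)).trans
      (ih'.mono (List.subset_append_right _ _) (List.subset_append_right _ _))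
  | branch_true _ _ ih =>
    exact ih.mono (List.subset_append_left _ _) (List.subset_append_left _ _)
  | branch_false _ _ ih =>
    exact ih.mono (List.subset_append_right _ _) (List.subset_append_right _ _)
  | loop_done _ => exact .refl _ _
  | loop_step _ _ _ ih ih' => exact Frame.trans ⟨ih.nat, ih.real⟩ ih'

/-- The program `P`, started with the memory `s`, halts after at most `B` steps with a memory that
satisfies `R`. -/
def Ends (P : Program) (s : Memory) (B : ℕ) (R : Memory → Prop) : Prop :=
  ∃ t s', Runs P s t s' ∧ t ≤ B ∧ R s'

theorem Ends.mono {P : Program} {s : Memory} {B B' : ℕ} {R R' : Memory → Prop} (h : Ends P s B R)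
    (hB : B ≤ B') (hR : ∀ s', Frame P s s' → R s' → R' s') :
    Ends P s B' R' := by
  obtain ⟨t, s', h, ht, hs⟩ := h
  exact ⟨t, s', h, ht.trans hB, hR s' h.frame hs⟩

theorem Ends.of_loopFree {P : Program} {s : Memory} {B : ℕ} {R : Memory → Prop}
    (h : P.LoopFree) (hB : P.maxCost ≤ B) (hR : R (P.run s)) : Ends P s B R := by
  obtain ⟨t, ht, hr⟩ := h.runs s
  exact ⟨t, _, hr, ht.trans hB, hR⟩

theorem Ends.seq {P Q : Program} {s : Memory} {B B' : ℕ} {R R' : Memory → Prop}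
    (h : Ends P s B R) (h' : ∀ s', Frame P s s' → R s' → Ends Q s' B' R') :
    Ends (.seq P Q) s (B + B') R' := by
  obtain ⟨t, s', h, ht, hs⟩ := h
  obtain ⟨t', s'', h', ht', hs'⟩ := h' s' h.frame hs
  exact ⟨t + t', s'', .seq h h', by omega, hs'⟩

/-- Straight-line code followed by a program. -/
theorem Ends.run_seq {P Q : Program} {s : Memory} {B B' : ℕ} {R : Memory → Prop}
    (h : P.LoopFree) (hB : P.maxCost ≤ B) (h' : Ends Q (P.run s) B' R) :
    Ends (.seq P Q) s (B + B') R :=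
  Ends.seq (R := fun s' => s' = P.run s) (.of_loopFree h hB rfl) fun _ _ hs => hs ▸ h'

theorem Ends.branch {b : Test} {P Q : Program} {s : Memory} {B : ℕ} {R : Memory → Prop}
    (hP : b.Holds s → Ends P s B R) (hQ : ¬ b.Holds s → Ends Q s B R) :
    Ends (.branch b P Q) s (b.cost + B) R := by
  by_cases hb : b.Holds s
  · obtain ⟨t, s', h, ht, hs⟩ := hP hb
    exact ⟨_, s', .branch_true hb h, by omega, hs⟩
  · obtain ⟨t, s', h, ht, hs⟩ := hQ hb
    exact ⟨_, s', .branch_false hb h, by omega, hs⟩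

/-- The loop rule: `I` is an invariant and `φ` is a potential that pays for the iterations. -/
theorem Ends.loop {b : Test} {P : Program} {s : Memory} (I : Memory → Prop) (φ : Memory → ℕ)
    (h0 : I s) (hstep : ∀ s', Frame P s s' → I s' → b.Holds s' →
      ∃ B, Ends P s' B fun s'' => I s'' ∧ b.cost + B + φ s'' ≤ φ s') :
    Ends (.loop b P) s (φ s + b.cost) fun s' => I s' ∧ ¬ b.Holds s' := by
  -- The induction is on an upper bound for the potential. A test costs at least 1, so every
  -- iteration lowers the potential strictly, and at potential 0 the test must fail.
  suffices H : ∀ N s', Frame P s s' → I s' → φ s' ≤ N →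
      Ends (.loop b P) s' (φ s' + b.cost) fun s' => I s' ∧ ¬ b.Holds s' from
    H _ s (.refl _ _) h0 le_rfl
  intro N
  induction N with
  | zero =>
    intro s' hF hI hN
    by_cases hb : b.Holds s'
    · obtain ⟨B, t, s'', h, ht, hI', hB⟩ := hstep s' hF hI hb
      have : 0 < b.cost := by cases b <;> simp [Test.cost]
      omega
    · exact ⟨_, s', .loop_done hb, by omega, hI, hb⟩
  | succ N ih =>
    intro s' hF hI hN
    by_cases hb : b.Holds s'
    · obtain ⟨B, t, s'', h, ht, hI', hB⟩ := hstep s' hF hI hb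
      have : 0 < b.cost := by cases b <;> simp [Test.cost]
      obtain ⟨t', s₃, h', ht', hI₃⟩ := ih s'' (hF.trans h.frame) hI' (by omega)
      exact ⟨_, s₃, .loop_step hb h h', by omega, hI₃⟩
    · exact ⟨_, s', .loop_done hb, by omega, hI, hb⟩

/-! ### Linked lists of indices with equal keys -/

/-- The loop body of `bucket`. -/
def bucketBody (i h nx : ℕ) (key : NatExpr) : Program :=
  .seq (.setNat nx (.var i) (.get h key))
    (.seq (.setNat h key (.var i)) (.setNat i (.const 0) (.add (.var i) (.const 1))))

/-- Distribution of the indices `1, …, cnt` to linked lists according to their keys: `h` holds the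
last index with a given key, and `nx` the previous index with the same key; `i` is the counter. -/
def bucket (i h nx : ℕ) (cnt key : NatExpr) : Program :=
  .seq (.setNat i (.const 0) (.const 1)) (.loop (.natLE (.var i) cnt) (bucketBody i h nx key))

/-- `Nat.findGreatest` returns 0 if nothing is found, so with indices starting at 1 the value 0
marks the end of a list, and an array `h` of zeros represents empty lists. The expressions `cnt` and
`key` are evaluated anew in every iteration; hence the hypotheses on them range over all memories in
the frame. -/
theorem bucket_ends {i h nx : ℕ} {cnt key : NatExpr} {s : Memory} {N : ℕ} {K : ℕ → ℕ}
    (hih : i ≠ h) (hin : i ≠ nx) (hhn : h ≠ nx) (h0 : ∀ k, s.nat h k = 0)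
    (hcnt : ∀ s', Frame (bucket i h nx cnt key) s s' → cnt.eval s' = N)
    (hkey : ∀ s', Frame (bucket i h nx cnt key) s s' → key.eval s' = K (s'.nat i 0)) :
    Ends (bucket i h nx cnt key) s ((2 * cnt.cost + 2 * key.cost + 20) * (N + 1)) fun s' =>
      (∀ k, s'.nat h k = Nat.findGreatest (fun q => K q = k) N) ∧
      ∀ q, 1 ≤ q → q ≤ N → s'.nat nx q = Nat.findGreatest (fun q' => K q' = K q) (q - 1) := by
  have frame1 : ∀ s', Frame (.setNat i (.const 0) (.const 1)) s s' →
      Frame (bucket i h nx cnt key) s s' := fun s' hs => hs.mono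
    (by simp [bucket, Program.natWrites]) (by simp [bucket, Program.realWrites])
  have frame2 : ∀ s' s'', Frame (bucketBody i h nx key) s' s'' →
      Frame (bucket i h nx cnt key) s' s'' := fun s' s'' hs => hs.mono
    (by simp [bucket, bucketBody, Program.natWrites])
    (by simp [bucket, bucketBody, Program.realWrites])
  have hL : ∀ s', Frame (.setNat i (.const 0) (.const 1)) s s' →
      s' = s.writeNat i 0 1 →
      Ends (.loop (.natLE (.var i) cnt) (bucketBody i h nx key)) s'
        ((cnt.cost + 2 * key.cost + 17) * N + (cnt.cost + 3)) fun s' =>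
        (∀ k, s'.nat h k = Nat.findGreatest (fun q => K q = k) N) ∧
        ∀ q, 1 ≤ q → q ≤ N →
          s'.nat nx q = Nat.findGreatest (fun q' => K q' = K q) (q - 1) := by
    intro s' hF hs'
    refine (Ends.loop
      (I := fun t => 1 ≤ t.nat i 0 ∧ t.nat i 0 ≤ N + 1 ∧
        (∀ k, t.nat h k = Nat.findGreatest (fun q => K q = k) (t.nat i 0 - 1)) ∧
        ∀ q, 1 ≤ q → q < t.nat i 0 →
          t.nat nx q = Nat.findGreatest (fun q' => K q' = K q) (q - 1))
      (φ := fun t => (cnt.cost + 2 * key.cost + 17) * (N + 1 - t.nat i 0)) ?_ ?_).mono ?_ ?_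
    · subst hs'
      simp [Memory.writeNat_nat, hih.symm, h0]
      intro q h1 h2; omega
    · rintro t hF' ⟨h1, h2, h3, h4⟩ hb
      have hFt := (frame1 _ hF).trans (frame2 _ _ ⟨hF'.nat, hF'.real⟩)
      have hc := hcnt t hFt
      have hk := hkey t hFt
      simp only [Test.Holds, hc, NatExpr.eval] at hb
      -- The body evaluates `key` a second time after the write to `nx`, so the hypothesis on the
      -- keys is also needed at this intermediate memory.
      set t1 := t.writeNat nx (t.nat i 0) (t.nat h (key.eval t)) with ht1
      have hFt1 : Frame (bucket i h nx cnt key) s t1 := by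
        refine hFt.trans ⟨fun a ha => ?_, fun a ha => rfl⟩
        have : a ≠ nx := by
          rintro rfl; simp [bucket, bucketBody, Program.natWrites] at ha
        simp [ht1, Memory.writeNat_nat, this]
      have hk1 := hkey t1 hFt1
      have hi1 : t1.nat i = t.nat i := by simp [ht1, Memory.writeNat_nat, hin]
      rw [hi1] at hk1
      refine ⟨_, .of_loopFree (by simp [bucketBody, Program.LoopFree]) le_rfl ?_⟩
      have hrun : (bucketBody i h nx key).run t =
          (t1.writeNat h (K (t.nat i 0)) (t.nat i 0)).writeNat i 0 (t.nat i 0 + 1) := by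
        simp [bucketBody, Program.run, NatExpr.eval, ← ht1, hk1, hi1, Memory.writeNat_nat, hih]
      rw [hrun]
      simp only [Memory.writeNat_nat, hih, hin, hih.symm, hin.symm, hhn, hhn.symm, if_true,
        if_false, ht1, hk, Function.update_self]
      refine ⟨⟨by omega, by omega, ?_, ?_⟩, ?_⟩
      · intro k
        obtain ⟨j, hj⟩ : ∃ j, t.nat i 0 = j + 1 := ⟨_, (Nat.sub_add_cancel h1).symm⟩
        rw [hj, Nat.add_sub_cancel, Nat.findGreatest_succ, Function.update_apply]
        by_cases hkk : K (j + 1) = k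
        · simp [hkk]
        · rw [if_neg hkk, if_neg (Ne.symm hkk), h3, hj, Nat.add_sub_cancel]
      · intro q hq1 hq2
        rw [Function.update_apply]
        split_ifs with hq
        · rw [hq, h3]
        · exact h4 q hq1 (by omega)
      · simp only [Test.cost, bucketBody, Program.maxCost, NatExpr.cost]
        have : N + 1 - t.nat i 0 = N + 1 - (t.nat i 0 + 1) + 1 := by omega
        rw [this]
        ring_nf; omega
    · subst hs'
      simp [Memory.writeNat_nat, Test.cost, NatExpr.cost]
      omega
    · rintro t hF' ⟨⟨h1, h2, h3, h4⟩, hb⟩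
      have hFt := (frame1 _ hF).trans (frame2 _ _ ⟨hF'.nat, hF'.real⟩)
      have hc := hcnt t hFt
      simp only [Test.Holds, hc, NatExpr.eval] at hb
      have : t.nat i 0 = N + 1 := by omega
      rw [this] at h3 h4
      exact ⟨fun k => by rw [h3]; rfl, fun q hq1 hq2 => h4 q hq1 (by omega)⟩
  refine (Ends.seq (.of_loopFree (P := .setNat i (.const 0) (.const 1))
    (R := fun s' => s' = s.writeNat i 0 1) trivial le_rfl rfl)
    hL).mono ?_ fun _ _ h => h
  simp [Program.maxCost, NatExpr.cost]
  ring_nf; omega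

/-! ### Heap sort -/

/-- The sequence `H'` is a rearrangement of `H` within the positions `lo, …, hi`. -/
def Rearranged (lo hi : ℕ) (H H' : ℕ → ℕ) : Prop :=
  ∃ π : Equiv.Perm ℕ, (∀ i, i < lo ∨ hi < i → π i = i) ∧ ∀ i, H' i = H (π i)

theorem Rearranged.refl (lo hi : ℕ) (H : ℕ → ℕ) : Rearranged lo hi H H :=
  ⟨1, fun _ _ => rfl, fun _ => rfl⟩

theorem Rearranged.trans {lo hi : ℕ} {H H' H'' : ℕ → ℕ} (h : Rearranged lo hi H H')
    (h' : Rearranged lo hi H' H'') : Rearranged lo hi H H'' := by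
  obtain ⟨π, h1, h2⟩ := h
  obtain ⟨ρ, h3, h4⟩ := h'
  refine ⟨ρ.trans π, fun i hi => ?_, fun i => ?_⟩
  · simp [h3 i hi, h1 i hi]
  · simp [h4, h2]

theorem Rearranged.mono {lo hi lo' hi' : ℕ} {H H' : ℕ → ℕ} (h : Rearranged lo hi H H')
    (hlo : lo' ≤ lo) (hhi : hi ≤ hi') : Rearranged lo' hi' H H' := by
  obtain ⟨π, h1, h2⟩ := h
  exact ⟨π, fun i hi => h1 i (by omega), h2⟩

theorem Rearranged.swap {lo hi a b : ℕ} (H : ℕ → ℕ) (ha : lo ≤ a) (ha' : a ≤ hi) (hb : lo ≤ b)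
    (hb' : b ≤ hi) :
    Rearranged lo hi H (Function.update (Function.update H a (H b)) b (H a)) := by
  refine ⟨Equiv.swap a b, fun i hi => ?_, fun i => ?_⟩
  · exact Equiv.swap_apply_of_ne_of_ne (by omega) (by omega)
  · simp only [Function.update_apply, Equiv.swap_apply_def]
    split_ifs <;> simp_all

/-- The permutation fixes every position outside the interval, so by injectivity it cannot carry a
position out of the interval. -/
theorem Rearranged.exists_mem {lo hi : ℕ} {H H' : ℕ → ℕ} (h : Rearranged lo hi H H') (i : ℕ)
    (h1 : lo ≤ i) (h2 : i ≤ hi) : ∃ j, lo ≤ j ∧ j ≤ hi ∧ H' i = H j := by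
  obtain ⟨π, h3, h4⟩ := h
  refine ⟨π i, ?_, ?_, h4 i⟩ <;> by_contra hc
  · have := π.injective (h3 (π i) (by omega)); omega
  · have := π.injective (h3 (π i) (by omega)); omega

theorem Rearranged.symm {lo hi : ℕ} {H H' : ℕ → ℕ} (h : Rearranged lo hi H H') :
    Rearranged lo hi H' H := by
  obtain ⟨π, h1, h2⟩ := h
  refine ⟨π.symm, fun i hi => ?_, fun i => by simp [h2]⟩
  rw [Equiv.symm_apply_eq, h1 i hi]

theorem Rearranged.eq_of_lt {lo hi : ℕ} {H H' : ℕ → ℕ} (h : Rearranged lo hi H H') {i : ℕ}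
    (hi' : hi < i) : H' i = H i := by
  obtain ⟨π, h1, h2⟩ := h
  rw [h2, h1 i (.inr hi')]

theorem Rearranged.injOn {lo hi : ℕ} {H H' : ℕ → ℕ} (h : Rearranged lo hi H H')
    (hH : Set.InjOn H (Set.Icc lo hi)) : Set.InjOn H' (Set.Icc lo hi) := by
  obtain ⟨π, h1, h2⟩ := h
  have hm : ∀ i ∈ Set.Icc lo hi, π i ∈ Set.Icc lo hi := by
    intro i hi
    by_contra hc
    have := π.injective (h1 (π i) (by simp only [Set.mem_Icc] at hc; omega))
    rw [this] at hc; exact hc hi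
  intro i hi j hj hij
  rw [h2, h2] at hij
  exact π.injective (hH (hm i hi) (hm j hj) hij)

/-- The positions `lo, …, hi` of `H` satisfy the heap condition for the keys `p`, with the smallest
key on top. -/
def IsHeap (p : ℕ → ℝ) (H : ℕ → ℕ) (lo hi : ℕ) : Prop :=
  ∀ a b, lo ≤ a → b ≤ hi → b = 2 * a ∨ b = 2 * a + 1 → p (H a) ≤ p (H b)

/-- The heap condition, except that the entry at the position `k` may be too large. -/
structure IsHeapExcept (p : ℕ → ℝ) (H : ℕ → ℕ) (lo hi k : ℕ) : Prop where
  le : ∀ a b, lo ≤ a → a ≠ k → b ≤ hi → b = 2 * a ∨ b = 2 * a + 1 → p (H a) ≤ p (H b)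
  skip : ∀ a b, lo ≤ a → k = 2 * a ∨ k = 2 * a + 1 → b ≤ hi → b = 2 * k ∨ b = 2 * k + 1 →
    p (H a) ≤ p (H b)

theorem IsHeapExcept.isHeap {p : ℕ → ℝ} {H : ℕ → ℕ} {lo hi k : ℕ}
    (h : IsHeapExcept p H lo hi k) (hk : ∀ b, b ≤ hi → b = 2 * k ∨ b = 2 * k + 1 →
      p (H k) ≤ p (H b)) : IsHeap p H lo hi := fun a b ha hb hab => by
  by_cases hak : a = k
  · subst hak; exact hk b hb hab
  · exact h.le a b ha hak hb hab

/-- The entry that rises to `k` has a key at most that of its sibling, by minimality, and at least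
that of the parent of `k`, by `skip`. The only possible violation moves down to `c`, and `skip` at
`c` is the old heap condition between `c` and its children. -/
theorem IsHeapExcept.sift {p : ℕ → ℝ} {H : ℕ → ℕ} {lo hi k c : ℕ}
    (h : IsHeapExcept p H lo hi k) (h1 : 1 ≤ lo) (hk : lo ≤ k) (hc : c = 2 * k ∨ c = 2 * k + 1)
    (hchi : c ≤ hi)
    (hmin : ∀ b, b ≤ hi → b = 2 * k ∨ b = 2 * k + 1 → p (H c) ≤ p (H b))
    (hlt : p (H c) ≤ p (H k)) :
    IsHeapExcept p (Function.update (Function.update H k (H c)) c (H k)) lo hi c := by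
  constructor
  · intro a b ha hac hb hab
    rw [Function.update_of_ne hac]
    by_cases hak : a = k
    · subst hak
      rw [Function.update_self, Function.update_apply]
      split_ifs with hbc
      · exact hlt
      · rw [Function.update_of_ne (by omega)]
        exact hmin b hb hab
    · rw [Function.update_of_ne hak, Function.update_of_ne (by omega)]
      by_cases hbk : b = k
      · subst hbk
        rw [Function.update_self]
        exact h.skip a c ha hab hchi hc
      · rw [Function.update_of_ne hbk]
        exact h.le a b ha hak hb hab
  · intro a b ha hca hb hbc
    obtain rfl : a = k := by omega
    rw [Function.update_of_ne (by omega), Function.update_self, Function.update_of_ne (by omega),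
      Function.update_of_ne (by omega)]
    exact h.le c b (by omega) (by omega) hb hbc

theorem IsHeap.root_le {p : ℕ → ℝ} {H : ℕ → ℕ} {hi : ℕ} (h : IsHeap p H 1 hi) :
    ∀ i, 1 ≤ i → i ≤ hi → p (H 1) ≤ p (H i) := by
  intro i
  induction i using Nat.strong_induction_on with
  | _ i ih =>
    intro h1 h2
    by_cases hi1 : i = 1
    · rw [hi1]
    · exact (ih (i / 2) (by omega) (by omega) (by omega)).trans
        (h _ _ (by omega) h2 (by omega))

/-- The processing time of the edge at a position of the heap. -/
abbrev heapKey (k : NatExpr) : RealExpr := .get 1 (.get 6 k)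

/-- Selection of the child with the smaller key. -/
def selectChild : Program :=
  .seq (.setNat 13 (.const 0) (.add (.var 12) (.var 12)))
    (.branch (.natLE (.add (.add (.var 12) (.var 12)) (.const 1)) (.var 11))
      (.branch (.realLE (heapKey (.add (.add (.var 12) (.var 12)) (.const 1)))
          (heapKey (.add (.var 12) (.var 12))))
        (.setNat 13 (.const 0) (.add (.add (.var 12) (.var 12)) (.const 1))) .skip) .skip)

/-- The entry at the position `k` is compared with the smaller child and moved if necessary. -/
def siftBody : Program :=
  .seq selectChild
    (.branch (.realLE (heapKey (.var 12)) (heapKey (.var 13)))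
      (.setNat 12 (.const 0) (.add (.var 11) (.const 1)))
      (.seq (.setNat 14 (.const 0) (.get 6 (.var 12)))
        (.seq (.setNat 6 (.var 12) (.get 6 (.var 13)))
          (.seq (.setNat 6 (.var 13) (.var 14)) (.setNat 12 (.const 0) (.var 13))))))

/-- The entry at the position `k` sinks in the heap. -/
def siftDown : Program := .loop (.natLE (.add (.var 12) (.var 12)) (.var 11)) siftBody

theorem selectChild_run (s : Memory) {k : ℕ} (hk : s.nat 12 0 = k) (hhi : 2 * k ≤ s.nat 11 0) :
    ∃ c, selectChild.run s = s.writeNat 13 0 c ∧ (c = 2 * k ∨ c = 2 * k + 1) ∧ c ≤ s.nat 11 0 ∧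
      ∀ b, b ≤ s.nat 11 0 → b = 2 * k ∨ b = 2 * k + 1 →
        s.real 1 (s.nat 6 c) ≤ s.real 1 (s.nat 6 b) := by
  subst hk
  have e : s.nat 12 0 + s.nat 12 0 = 2 * s.nat 12 0 := by ring
  by_cases h1 : 2 * s.nat 12 0 + 1 ≤ s.nat 11 0
  · by_cases h2 : s.real 1 (s.nat 6 (2 * s.nat 12 0 + 1)) ≤ s.real 1 (s.nat 6 (2 * s.nat 12 0))
    · refine ⟨2 * s.nat 12 0 + 1, ?_, .inr rfl, h1, ?_⟩
      · simp [selectChild, Program.run, Test.Holds, NatExpr.eval, RealExpr.eval,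
          Memory.writeNat_nat, Memory.writeNat_real, e, h1, h2]
        simp [Memory.writeNat]
        funext b l
        by_cases hb : b = 13 ∧ l = 0 <;> simp [hb]
      · rintro b - (rfl | rfl)
        · exact h2
        · exact le_rfl
    · refine ⟨2 * s.nat 12 0, ?_, .inl rfl, hhi, ?_⟩
      · simp [selectChild, Program.run, Test.Holds, NatExpr.eval, RealExpr.eval,
          Memory.writeNat_nat, Memory.writeNat_real, e, h1, h2]
      · rintro b - (rfl | rfl)
        · exact le_rfl
        · exact (not_le.1 h2).le
  · refine ⟨2 * s.nat 12 0, ?_, .inl rfl, hhi, ?_⟩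
    · simp [selectChild, Program.run, Test.Holds, NatExpr.eval, Memory.writeNat_nat, e, h1]
    · rintro b hb (rfl | rfl)
      · exact le_rfl
      · exact absurd hb h1

/-- Every iteration at least doubles the position, so its binary logarithm serves as a clock with at
most `K` ticks. -/
theorem siftDown_ends (s : Memory) {p : ℕ → ℝ} {lo hi K : ℕ} (hp : s.real 1 = p)
    (hhi : s.nat 11 0 = hi) (hlo : 1 ≤ lo) (hk : lo ≤ s.nat 12 0) (hK : hi < 2 ^ K)
    (hH : IsHeapExcept p (s.nat 6) lo hi (s.nat 12 0)) :
    Ends siftDown s (100 * (K + 1)) fun s' =>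
      IsHeap p (s'.nat 6) lo hi ∧ Rearranged lo hi (s.nat 6) (s'.nat 6) := by
  refine (Ends.loop (I := fun t => lo ≤ t.nat 12 0 ∧ IsHeapExcept p (t.nat 6) lo hi (t.nat 12 0) ∧
      Rearranged lo hi (s.nat 6) (t.nat 6)) (φ := fun t => 90 * (K - Nat.log 2 (t.nat 12 0)))
      ⟨hk, hH, .refl _ _ _⟩ ?_).mono ?_ ?_
  · rintro t hF ⟨h1, h2, h3⟩ hb
    have h11 : t.nat 11 0 = hi := by rw [hF.nat 11 (by decide), hhi]
    have hr1 : t.real 1 = p := by rw [hF.real 1 (by decide), hp]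
    simp only [Test.Holds, NatExpr.eval, h11] at hb
    set k := t.nat 12 0 with hkdef
    obtain ⟨c, hrun, hc, hchi, hmin⟩ := selectChild_run t hkdef.symm (by omega)
    rw [hr1] at hmin
    rw [h11] at hchi hmin
    have hlog : Nat.log 2 k < K := Nat.log_lt_of_lt_pow (by omega) (by omega)
    have hlogc : ∀ j, 2 * k ≤ j → Nat.log 2 k + 1 ≤ Nat.log 2 j := by
      intro j hj
      rw [← Nat.log_mul_base (by norm_num) (by omega)]
      exact Nat.log_mono_right (by omega)
    refine ⟨80, .of_loopFree (by simp [siftBody, selectChild, Program.LoopFree]) (by decide) ?_⟩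
    simp only [siftBody, Program.run, hrun, Test.Holds, NatExpr.eval, RealExpr.eval,
      Memory.writeNat_nat, Memory.writeNat_real, hr1, Test.cost, NatExpr.cost]
    by_cases hle : p (t.nat 6 k) ≤ p (t.nat 6 c)
    · simp only [← hkdef, hle, if_true, Nat.reduceEqDiff, if_false,
        Function.update_self, h11, Memory.writeNat_nat]
      -- The entry stays in place and the position jumps to `hi + 1`: this ends the loop, and an
      -- exception at `hi + 1` is vacuous, so the full heap condition is required and available.
      refine ⟨⟨by omega, ⟨fun a b ha hak hb' hab => ?_, fun a b ha hak hb' hab => by omega⟩, h3⟩, ?_⟩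
      · exact h2.isHeap (fun b hb1 hb2 => hle.trans (hmin b hb1 hb2)) a b ha hb' hab
      · have := hlogc (hi + 1) (by omega)
        omega
    · simp only [← hkdef, hle, if_true, Nat.reduceEqDiff, if_false,
        Function.update_self, h11, Memory.writeNat_nat]
      refine ⟨⟨by omega, ?_, h3.trans (.swap _ (by omega) (by omega) (by omega) (by omega))⟩, ?_⟩
      · exact h2.sift hlo h1 hc hchi hmin (not_le.1 hle).le
      · have := hlogc c (by omega)
        omega
  · simp only [Test.cost, NatExpr.cost]
    have : K - Nat.log 2 (s.nat 12 0) ≤ K := Nat.sub_le _ _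
    omega
  · rintro t hF ⟨⟨h1, h2, h3⟩, hb⟩
    have h11 : t.nat 11 0 = hi := by rw [hF.nat 11 (by decide), hhi]
    simp only [Test.Holds, NatExpr.eval, h11] at hb
    exact ⟨h2.isHeap fun b hb1 hb2 => by omega, h3⟩

/-- The next step of heap sort before the sinking: either the heap is extended to the left, or the
smallest entry is moved to the end. -/
def heapStep : Program :=
  .seq (.branch (.natLE (.const 2) (.var 10))
      (.setNat 10 (.const 0) (.sub (.var 10) (.const 1)))
      (.seq (.setNat 14 (.const 0) (.get 6 (.const 1)))
        (.seq (.setNat 6 (.const 1) (.get 6 (.var 11)))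
          (.seq (.setNat 6 (.var 11) (.var 14))
            (.setNat 11 (.const 0) (.sub (.var 11) (.const 1)))))))
    (.setNat 12 (.const 0) (.var 10))

/-- Heap sort of the positions `1, …, d` of the natural number array `6` by decreasing processing
times; `d` is held by the array `8`. -/
def heapSort : Program :=
  .seq (.seq (.setNat 10 (.const 0) (.add (.var 8) (.const 1))) (.setNat 11 (.const 0) (.var 8)))
    (.loop (.natLE (.const 1) (.var 11)) (.seq heapStep siftDown))

/-- One loop covers both phases: as long as the lower bound exceeds 1 the heap grows to the left,
afterwards its minimum is moved behind the upper bound. Each step lowers the sum of the two bounds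
by 1. No key behind the upper bound exceeds a key at an earlier position, which in the end is the
decreasing order. -/
theorem heapSort_ends (s : Memory) {p : ℕ → ℝ} {d K : ℕ} (hp : s.real 1 = p)
    (hd : s.nat 8 0 = d) (hK : d < 2 ^ K) :
    Ends heapSort s (400 * (K + 1) * (d + 1)) fun s' =>
      Rearranged 1 d (s.nat 6) (s'.nat 6) ∧
      ∀ i l, 1 ≤ i → i ≤ l → l ≤ d → p (s'.nat 6 l) ≤ p (s'.nat 6 i) := by
  refine (Ends.run_seq (B := 12) (B' := 200 * (K + 1) * (2 * d + 1) + 4)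
    (by simp [Program.LoopFree]) (by decide) ?_).mono (by ring_nf; omega) fun _ _ h => h
  set s0 := Program.run _ s with hs0
  have e6 : s0.nat 6 = s.nat 6 := by simp [hs0, Program.run, Memory.writeNat_nat]
  have e10 : s0.nat 10 0 = d + 1 := by simp [hs0, Program.run, Memory.writeNat_nat, NatExpr.eval, hd]
  have e11 : s0.nat 11 0 = d := by simp [hs0, Program.run, Memory.writeNat_nat, NatExpr.eval, hd]
  have er : s0.real 1 = p := by simp [hs0, Program.run, Memory.writeNat_real, hp]
  clear_value s0
  refine (Ends.loop (I := fun t => 1 ≤ t.nat 10 0 ∧ t.nat 11 0 ≤ d ∧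
      IsHeap p (t.nat 6) (t.nat 10 0) (t.nat 11 0) ∧ Rearranged 1 d (s.nat 6) (t.nat 6) ∧
      (∀ i l, 1 ≤ i → i ≤ l → t.nat 11 0 < l → l ≤ d → p (t.nat 6 l) ≤ p (t.nat 6 i)) )
      (φ := fun t => 200 * (K + 1) * (t.nat 10 0 + t.nat 11 0)) ?_ ?_).mono ?_ ?_
  · rw [e6, e10, e11]
    exact ⟨by omega, le_rfl, fun a b ha hb hab => by omega, .refl _ _ _, fun i l _ _ _ _ => by omega⟩
  · rintro t hF ⟨h1, h2, h3, h4, h5⟩ hb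
    simp only [Test.Holds, NatExpr.eval] at hb
    have hr1 : t.real 1 = p := by rw [hF.real 1 (by decide), er]
    refine ⟨_, Ends.run_seq (B := 60) (by simp [heapStep, Program.LoopFree]) (by decide) (?_ :
      Ends siftDown _ (100 * (K + 1)) _)⟩
    simp only [Test.cost, NatExpr.cost]
    by_cases hlo : 2 ≤ t.nat 10 0
    · set t1 := heapStep.run t with ht1
      have f6 : t1.nat 6 = t.nat 6 := by
        simp [ht1, heapStep, Program.run, Test.Holds, NatExpr.eval, hlo, Memory.writeNat_nat]
      have f10 : t1.nat 10 0 = t.nat 10 0 - 1 := by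
        simp [ht1, heapStep, Program.run, Test.Holds, NatExpr.eval, hlo, Memory.writeNat_nat]
      have f11 : t1.nat 11 0 = t.nat 11 0 := by
        simp [ht1, heapStep, Program.run, Test.Holds, NatExpr.eval, hlo, Memory.writeNat_nat]
      have f12 : t1.nat 12 0 = t.nat 10 0 - 1 := by
        simp [ht1, heapStep, Program.run, Test.Holds, NatExpr.eval, hlo, Memory.writeNat_nat]
      have fr : t1.real 1 = p := by
        simp [ht1, heapStep, Program.run, Test.Holds, NatExpr.eval, hlo, Memory.writeNat_real, hr1]
      clear_value t1
      refine (siftDown_ends t1 (lo := t.nat 10 0 - 1) (K := K) fr rfl (by omega) (by omega)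
        (by omega) ?_).mono le_rfl ?_
      · rw [f6, f12, f11]
        exact ⟨fun a b ha hak hb' hab => h3 a b (by omega) hb' hab,
          fun a b ha hak hb' hab => by omega⟩
      · rintro t2 hF2 ⟨g1, g2⟩
        rw [f11] at g1 g2
        rw [f6] at g2
        rw [hF2.nat 10 (by decide), hF2.nat 11 (by decide), f10, f11]
        refine ⟨⟨by omega, h2, g1, h4.trans (g2.mono (by omega) h2), ?_⟩, ?_⟩
        · intro i l hi1 hil hl hld
          rw [g2.eq_of_lt hl]
          by_cases hil' : t.nat 11 0 < i
          · rw [g2.eq_of_lt hil']; exact h5 i l hi1 hil hl hld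
          · obtain ⟨j, hj1, hj2, hj3⟩ := (g2.mono (lo' := 1) (by omega) le_rfl).exists_mem i hi1
              (by omega)
            rw [hj3]; exact h5 j l hj1 (by omega) hl hld
        · obtain ⟨v, hv⟩ : ∃ v, t.nat 10 0 = v + 1 := ⟨t.nat 10 0 - 1, by omega⟩
          rw [hv, Nat.add_sub_cancel]
          ring_nf; omega
    · have hlo1 : t.nat 10 0 = 1 := by omega
      set t1 := heapStep.run t with ht1
      have f6 : t1.nat 6 = Function.update (Function.update (t.nat 6) 1 (t.nat 6 (t.nat 11 0)))
          (t.nat 11 0) (t.nat 6 1) := by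
        simp [ht1, heapStep, Program.run, Test.Holds, NatExpr.eval, hlo1, Memory.writeNat_nat]
      have f10 : t1.nat 10 0 = 1 := by
        simp [ht1, heapStep, Program.run, Test.Holds, NatExpr.eval, hlo1, Memory.writeNat_nat]
      have f11 : t1.nat 11 0 = t.nat 11 0 - 1 := by
        simp [ht1, heapStep, Program.run, Test.Holds, NatExpr.eval, hlo1, Memory.writeNat_nat]
      have f12 : t1.nat 12 0 = 1 := by
        simp [ht1, heapStep, Program.run, Test.Holds, NatExpr.eval, hlo1, Memory.writeNat_nat]
      have fr : t1.real 1 = p := by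
        simp [ht1, heapStep, Program.run, Test.Holds, NatExpr.eval, hlo1, Memory.writeNat_real, hr1]
      clear_value t1
      rw [hlo1] at h3
      have hsw : Rearranged 1 (t.nat 11 0) (t.nat 6) (t1.nat 6) := by
        rw [f6]; exact .swap _ le_rfl hb hb le_rfl
      refine (siftDown_ends t1 (lo := 1) (K := K) fr rfl le_rfl (by omega)
        (by omega) ?_).mono le_rfl ?_
      · rw [f6, f12, f11]
        refine ⟨fun a b ha hak hb' hab => ?_, fun a b ha hak hb' hab => by omega⟩
        rw [Function.update_of_ne (by omega), Function.update_of_ne (by omega),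
          Function.update_of_ne (by omega), Function.update_of_ne (by omega)]
        exact h3 a b ha (by omega) hab
      · rintro t2 hF2 ⟨g1, g2⟩
        rw [f11] at g1 g2
        rw [hF2.nat 10 (by decide), hF2.nat 11 (by decide), f10, f11]
        have hsw2 : Rearranged 1 (t.nat 11 0) (t.nat 6) (t2.nat 6) :=
          hsw.trans (g2.mono le_rfl (by omega))
        refine ⟨⟨by omega, by omega, g1, h4.trans (hsw2.mono le_rfl h2), ?_⟩, ?_⟩
        · intro i l hi1 hil hl hld
          have key : ∀ i, 1 ≤ i → i ≤ l → ∃ j, 1 ≤ j ∧ j ≤ l ∧ t2.nat 6 i = t.nat 6 j :=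
            fun i hi1 hil => (hsw2.mono le_rfl (by omega)).exists_mem i hi1 hil
          obtain ⟨j, hj1, hj2, hj3⟩ := key i hi1 hil
          rw [hj3]
          -- The position that has just left the heap holds the old root, the minimum of the heap.
          by_cases hl' : l = t.nat 11 0
          · rw [g2.eq_of_lt (by omega), f6, hl', Function.update_self]
            exact h3.root_le j hj1 (by omega)
          · rw [hsw2.eq_of_lt (by omega)]
            exact h5 j l hj1 hj2 (by omega) hld
        · obtain ⟨v, hv⟩ : ∃ v, t.nat 11 0 = v + 1 := ⟨t.nat 11 0 - 1, by omega⟩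
          rw [hv, hlo1, Nat.add_sub_cancel]
          ring_nf; omega
  · rw [e10, e11]
    simp only [Test.cost, NatExpr.cost]
    apply le_of_eq; ring
  · rintro t hF ⟨⟨h1, h2, h3, h4, h5⟩, hb⟩
    simp only [Test.Holds, NatExpr.eval] at hb
    exact ⟨h4, fun i l hi1 hil hl => h5 i l hi1 hil (by omega) hl⟩

end RealRAM

namespace UnrelatedMachines

open RealRAM

/-! ### Distribution of the scaled fractional assignment to slots -/

/-- The data of a scheduling instance with the edges `0, …, N - 1`: the edge `e` joins the job
`job e` and the machine `mc e`. -/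
structure EdgeList (n N : ℕ) (job mc : ℕ → ℕ) (p x : ℕ → ℝ) (ε : ℝ) : Prop where
  eps_pos : 0 < ε
  eps_le : ε ≤ 1
  job_lt : ∀ e < N, job e < n
  inj : ∀ e < N, ∀ f < N, job e = job f → mc e = mc f → e = f
  p_pos : ∀ e < N, 0 < p e
  x_nonneg : ∀ e < N, 0 ≤ x e
  sum_eq_one : ∀ j < n, ∑ e ∈ (Finset.range N).filter (fun e => job e = j), x e = 1

theorem EdgeList.x_le_one {n N : ℕ} {job mc : ℕ → ℕ} {p x : ℕ → ℝ} {ε : ℝ}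
    (h : EdgeList n N job mc p x ε) {e : ℕ} (he : e < N) : x e ≤ 1 := by
  rw [← h.sum_eq_one (job e) (h.job_lt e he)]
  exact Finset.single_le_sum (f := x)
    (fun f hf => h.x_nonneg f (Finset.mem_range.1 (Finset.mem_filter.1 hf).1))
    (Finset.mem_filter.2 ⟨Finset.mem_range.2 he, rfl⟩)

/-- The total weight of the indices `1, …, Q` that `f` maps to `b`. -/
noncomputable def fiberSum (Q : ℕ) (f : ℕ → ℕ) (y : ℕ → ℝ) (b : ℕ) : ℝ :=
  ∑ q ∈ Finset.Icc 1 Q, if f q = b then y q else 0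

theorem fiberSum_append (Q : ℕ) (f : ℕ → ℕ) (y : ℕ → ℝ) (a b : ℕ) (z : ℝ) :
    fiberSum (Q + 1) (Function.update f (Q + 1) a) (Function.update y (Q + 1) z) b =
      fiberSum Q f y b + if a = b then z else 0 := by
  unfold fiberSum
  rw [Finset.sum_Icc_succ_top (by omega), Function.update_self, Function.update_self]
  congr 1
  refine Finset.sum_congr rfl fun q hq => ?_
  have := Finset.mem_Icc.1 hq
  rw [Function.update_of_ne (by omega), Function.update_of_ne (by omega)]

theorem fiberSum_eq_zero {Q : ℕ} {f : ℕ → ℕ} {y : ℕ → ℝ} {b : ℕ}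
    (h : ∀ q, 1 ≤ q → q ≤ Q → f q ≠ b) : fiberSum Q f y b = 0 :=
  Finset.sum_eq_zero fun q hq => if_neg (h q (Finset.mem_Icc.1 hq).1 (Finset.mem_Icc.1 hq).2)

/-- A distribution of fractional edges to slots: the pair `q` (for `1 ≤ q ≤ Q`) puts a part of weight
`y q` of the edge `pe q` into the slot `ps q`, which belongs to the machine `mach (ps q)`. The slots
of a machine are consecutive from `fs i` on, they are filled up one after the other, and
the processing times decrease from one slot to the next. Only machines in `D` have slots. -/
structure SlotSystem (N : ℕ) (mc : ℕ → ℕ) (p x : ℕ → ℝ) (D : ℕ → Prop) (Q T : ℕ)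
    (pe ps : ℕ → ℕ) (y : ℕ → ℝ) (mach fs : ℕ → ℕ) : Prop where
  edge_lt : ∀ q, 1 ≤ q → q ≤ Q → pe q < N
  x_pos : ∀ q, 1 ≤ q → q ≤ Q → 0 < x (pe q)
  y_nonneg : ∀ q, 1 ≤ q → q ≤ Q → 0 ≤ y q
  slot_pos : ∀ q, 1 ≤ q → q ≤ Q → 1 ≤ ps q
  slot_le : ∀ q, 1 ≤ q → q ≤ Q → ps q ≤ T
  mach_eq : ∀ q, 1 ≤ q → q ≤ Q → mach (ps q) = mc (pe q)
  done : ∀ t, 1 ≤ t → t ≤ T → D (mach t)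
  cap : ∀ t, fiberSum Q ps y t ≤ 1
  full : ∀ t, 1 ≤ t → t ≤ T → t = fs (mach t) ∨ (2 ≤ t ∧ mach (t - 1) = mach t ∧
    fiberSum Q ps y (t - 1) = 1 ∧ ∀ q q', 1 ≤ q → q ≤ Q → 1 ≤ q' → q' ≤ Q → ps q = t - 1 →
      ps q' = t → p (pe q') ≤ p (pe q))

/-- The invariant for the construction of the slots of the machine `i` with the edges
`H 1, …, H d`: the weight `w` of the edge `H idx` is not yet distributed, and the capacity `r` of
the slot `T` is left. -/
structure Emitting (N : ℕ) (mc : ℕ → ℕ) (p x : ℕ → ℝ) (ε : ℝ) (D : ℕ → Prop) (i d : ℕ) (H : ℕ → ℕ)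
    (Q T : ℕ) (pe ps : ℕ → ℕ) (y : ℕ → ℝ) (mach fs : ℕ → ℕ) (idx : ℕ) (w r : ℝ) : Prop where
  sys : SlotSystem N mc p x (fun k => D k ∨ k = i) Q T pe ps y mach fs
  sum_old : ∀ e < N, 0 < x e → D (mc e) → fiberSum Q pe y e = (1 + ε) * x e
  sum_lt : ∀ l, 1 ≤ l → l < idx → l ≤ d → fiberSum Q pe y (H l) = (1 + ε) * x (H l)
  sum_idx : idx ≤ d → fiberSum Q pe y (H idx) = (1 + ε) * x (H idx) - w
  sum_gt : ∀ l, idx < l → l ≤ d → fiberSum Q pe y (H l) = 0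
  idx_pos : 1 ≤ idx
  w_pos : idx ≤ d → 0 < w
  w_le : idx ≤ d → w ≤ 2
  slot : (r = 0 ∧ T + 1 = fs i) ∨
    (fs i ≤ T ∧ mach T = i ∧ 1 ≤ T ∧ fiberSum Q ps y T = 1 - r ∧ 0 ≤ r)
  order : ∀ q, 1 ≤ q → q ≤ Q → mc (pe q) = i → ∀ l, idx ≤ l → l ≤ d → p (H l) ≤ p (pe q)

section

variable {n N : ℕ} {job mc : ℕ → ℕ} {p x : ℕ → ℝ} {ε : ℝ} {D : ℕ → Prop} {i d : ℕ} {H : ℕ → ℕ}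
  {Q T : ℕ} {pe ps : ℕ → ℕ} {y : ℕ → ℝ} {mach fs : ℕ → ℕ} {idx : ℕ} {w r : ℝ}

/-- All existing slots belong to machines in `D`, hence none to `i`, and `fs i` can be redefined
without disturbing them. The capacity 0 makes the first iteration open a slot. -/
theorem Emitting.start (hI : EdgeList n N job mc p x ε)
    (h : SlotSystem N mc p x D Q T pe ps y mach fs)
    (hsum : ∀ e < N, 0 < x e → D (mc e) → fiberSum Q pe y e = (1 + ε) * x e) (hi : ¬ D i)
    (hH : ∀ l, 1 ≤ l → l ≤ d → H l < N ∧ 0 < x (H l) ∧ mc (H l) = i) :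
    Emitting N mc p x ε D i d H Q T pe ps y mach (Function.update fs i (T + 1)) 1
      ((1 + ε) * x (H 1)) 0 := by
  have hne : ∀ q, 1 ≤ q → q ≤ Q → mc (pe q) ≠ i := fun q h1 h2 hc => hi <| by
    rw [← hc, ← h.mach_eq q h1 h2]; exact h.done _ (h.slot_pos q h1 h2) (h.slot_le q h1 h2)
  have h0 : ∀ l, 1 ≤ l → l ≤ d → fiberSum Q pe y (H l) = 0 := fun l h1 h2 =>
    fiberSum_eq_zero fun q hq1 hq2 hc => hne q hq1 hq2 (by rw [hc]; exact (hH l h1 h2).2.2)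
  refine ⟨⟨h.edge_lt, h.x_pos, h.y_nonneg, h.slot_pos, h.slot_le, h.mach_eq,
    fun t h1 h2 => .inl (h.done t h1 h2), h.cap, fun t h1 h2 => ?_⟩, hsum, fun l h1 h2 => by omega,
    fun h1 => by rw [h0 1 le_rfl h1]; ring, fun l h1 h2 => h0 l (by omega) h2, le_rfl,
    fun h1 => ?_, fun h1 => ?_, .inl ⟨rfl, by simp⟩, fun q h1 h2 h3 => absurd h3 (hne q h1 h2)⟩
  · have : mach t ≠ i := fun hc => hi (hc ▸ h.done t h1 h2)
    rw [Function.update_of_ne this]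
    exact h.full t h1 h2
  · have := hI.eps_pos
    have := (hH 1 le_rfl h1).2.1
    positivity
  · have h2 := hI.x_le_one (hH 1 le_rfl h1).1
    have h3 := (hH 1 le_rfl h1).2.1
    have := hI.eps_pos
    have := hI.eps_le
    nlinarith

/-- If `i` already has a slot, then `r ≤ 0` and the invariant `0 ≤ r` show that the last one is
exactly full. The comparison with the new slot is vacuous, because no pair lies in it yet. -/
theorem Emitting.open_slot (h : Emitting N mc p x ε D i d H Q T pe ps y mach fs idx w r)
    (hr : r ≤ 0) :
    Emitting N mc p x ε D i d H Q (T + 1) pe ps y (Function.update mach (T + 1) i) fs idx w 1 := by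
  obtain ⟨⟨g1, g2, g3, g4, g5, g6, g7, g8, g9⟩, h1, h2, h3, h4, h5, h6, h7, h8, h9⟩ := h
  have hm : ∀ t, t ≤ T → Function.update mach (T + 1) i t = mach t := fun t ht =>
    Function.update_of_ne (by omega) _ _
  refine ⟨⟨g1, g2, g3, g4, fun q hq1 hq2 => (g5 q hq1 hq2).trans (by omega), fun q hq1 hq2 => ?_,
    fun t ht1 ht2 => ?_, g8, fun t ht1 ht2 => ?_⟩, h1, h2, h3, h4, h5, h6, h7, .inr ?_, h9⟩
  · rw [hm _ (g5 q hq1 hq2)]; exact g6 q hq1 hq2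
  · by_cases ht : t ≤ T
    · rw [hm t ht]; exact g7 t ht1 ht
    · obtain rfl : t = T + 1 := by omega
      simp
  · by_cases ht : t ≤ T
    · rw [hm t ht, hm (t - 1) (by omega)]; exact g9 t ht1 ht
    · obtain rfl : t = T + 1 := by omega
      rw [Function.update_self]
      rcases h8 with ⟨-, h8⟩ | ⟨a1, a2, a3, a4, a5⟩
      · exact .inl h8
      · refine .inr ⟨by omega, ?_, ?_, fun q q' _ _ hq1' hq2' _ hq' => ?_⟩
        · rw [hm _ (by omega)]; exact a2
        · rw [Nat.add_sub_cancel, a4]; linarith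
        · have := g5 q' hq1' hq2'; omega
  · refine ⟨by rcases h8 with h8 | h8 <;> omega, by simp, by omega, ?_, zero_le_one⟩
    rw [fiberSum_eq_zero fun q hq1 hq2 hc => by have := g5 q hq1 hq2; omega]
    ring

/-- The new pair has the weight `min w r`, so either the edge or the slot is exhausted. The capacity
`r - r` is left in this form because it is what the program computes. -/
theorem Emitting.append (hI : EdgeList n N job mc p x ε)
    (h : Emitting N mc p x ε D i d H Q T pe ps y mach fs idx w r) (hr : 0 < r) (hd : idx ≤ d)
    (hi : ¬ D i) (hH : ∀ l, 1 ≤ l → l ≤ d → H l < N ∧ 0 < x (H l) ∧ mc (H l) = i)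
    (hinj : Set.InjOn H (Set.Icc 1 d))
    (hord : ∀ k l, 1 ≤ k → k ≤ l → l ≤ d → p (H l) ≤ p (H k)) :
    (w ≤ r → Emitting N mc p x ε D i d H (Q + 1) T (Function.update pe (Q + 1) (H idx))
      (Function.update ps (Q + 1) T) (Function.update y (Q + 1) w) mach fs (idx + 1)
      ((1 + ε) * x (H (idx + 1))) (r - w)) ∧
    (r < w → Emitting N mc p x ε D i d H (Q + 1) T (Function.update pe (Q + 1) (H idx))
      (Function.update ps (Q + 1) T) (Function.update y (Q + 1) r) mach fs idx
      (w - r) (r - r)) := by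
  obtain ⟨⟨g1, g2, g3, g4, g5, g6, g7, g8, g9⟩, h1, h2, h3, h4, h5, h6, h7, h8, h9⟩ := h
  obtain ⟨a1, a2, a3, a4, a5⟩ := h8.resolve_left fun h => hr.ne' h.1
  obtain ⟨b1, b2, b3⟩ := hH idx h5 hd
  have hw := h6 hd
  have split : ∀ q, q ≤ Q + 1 → q = Q + 1 ∨ q ≤ Q := fun q hq => by omega
  have hu : ∀ {α : Type} (f : ℕ → α) (v : α) q, q ≤ Q → Function.update f (Q + 1) v q = f q :=
    fun f v q hq => Function.update_of_ne (by omega) _ _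
  have hsys : ∀ z, 0 ≤ z → z ≤ r → SlotSystem N mc p x (fun k => D k ∨ k = i) (Q + 1) T
      (Function.update pe (Q + 1) (H idx)) (Function.update ps (Q + 1) T)
      (Function.update y (Q + 1) z) mach fs := by
    intro z hz hzr
    refine ⟨?_, ?_, ?_, ?_, ?_, ?_, g7, ?_, ?_⟩
    · intro q hq1 hq2
      rcases split q hq2 with rfl | hq
      · simpa using b1
      · rw [hu _ _ _ hq]; exact g1 q hq1 hq
    · intro q hq1 hq2
      rcases split q hq2 with rfl | hq
      · simpa using b2
      · rw [hu _ _ _ hq]; exact g2 q hq1 hq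
    · intro q hq1 hq2
      rcases split q hq2 with rfl | hq
      · simpa using hz
      · rw [hu _ _ _ hq]; exact g3 q hq1 hq
    · intro q hq1 hq2
      rcases split q hq2 with rfl | hq
      · simpa using a3
      · rw [hu _ _ _ hq]; exact g4 q hq1 hq
    · intro q hq1 hq2
      rcases split q hq2 with rfl | hq
      · simp
      · rw [hu _ _ _ hq]; exact g5 q hq1 hq
    · intro q hq1 hq2
      rcases split q hq2 with rfl | hq
      · simp [a2, b3]
      · rw [hu _ _ _ hq, hu _ _ _ hq]; exact g6 q hq1 hq
    · intro t
      rw [fiberSum_append]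
      split_ifs with ht
      · rw [← ht, a4]; linarith
      · simpa using g8 t
    · intro t ht1 ht2
      refine (g9 t ht1 ht2).imp id ?_
      rintro ⟨c1, c2, c3, c4⟩
      refine ⟨c1, c2, ?_, ?_⟩
      · rw [fiberSum_append, if_neg (by omega), add_zero, c3]
      · intro q q' hq1 hq2 hq1' hq2' hq hq'
        rcases split q hq2 with rfl | hqQ
        · rw [Function.update_self] at hq; omega
        rw [hu _ _ _ hqQ] at hq
        rw [hu _ _ _ hqQ]
        rcases split q' hq2' with rfl | hqQ'
        -- The new pair lies in the slot `T`. The pairs in the slot before it belong to the same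
        -- machine, and the field `order` compares them with the current edge.
        · rw [Function.update_self] at hq' ⊢
          refine h9 q hq1 hqQ ?_ idx le_rfl hd
          rw [← g6 q hq1 hqQ, hq, c2, ← hq', a2]
        · rw [hu _ _ _ hqQ'] at hq' ⊢
          exact c4 q q' hq1 hqQ hq1' hqQ' hq hq'
  have hold : ∀ z, ∀ e < N, 0 < x e → D (mc e) → fiberSum (Q + 1)
      (Function.update pe (Q + 1) (H idx)) (Function.update y (Q + 1) z) e = (1 + ε) * x e := by
    intro z e he hx hD
    rw [fiberSum_append, if_neg (fun hc => hi (by rw [← b3, hc]; exact hD)), add_zero]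
    exact h1 e he hx hD
  have hothers : ∀ z l, 1 ≤ l → l ≤ d → l ≠ idx → fiberSum (Q + 1)
      (Function.update pe (Q + 1) (H idx)) (Function.update y (Q + 1) z) (H l) =
        fiberSum Q pe y (H l) := by
    intro z l hl1 hl2 hl
    rw [fiberSum_append, if_neg (fun hc => hl (hinj ⟨hl1, hl2⟩ ⟨h5, hd⟩ hc.symm)), add_zero]
  have hself : ∀ z, fiberSum (Q + 1)
      (Function.update pe (Q + 1) (H idx)) (Function.update y (Q + 1) z) (H idx) =
        (1 + ε) * x (H idx) - w + z := by
    intro z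
    rw [fiberSum_append, if_pos rfl, h3 hd]
  have hslot : ∀ z, z ≤ r → (fs i ≤ T ∧ mach T = i ∧ 1 ≤ T ∧ fiberSum (Q + 1)
      (Function.update ps (Q + 1) T) (Function.update y (Q + 1) z) T = 1 - (r - z) ∧ 0 ≤ r - z) := by
    intro z hz
    refine ⟨a1, a2, a3, ?_, by linarith⟩
    rw [fiberSum_append, if_pos rfl, a4]; ring
  have horder : ∀ q, 1 ≤ q → q ≤ Q + 1 → mc (Function.update pe (Q + 1) (H idx) q) = i →
      ∀ l, idx ≤ l → l ≤ d → p (H l) ≤ p (Function.update pe (Q + 1) (H idx) q) := by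
    intro q hq1 hq2 hq l hl1 hl2
    rcases split q hq2 with rfl | hqQ
    · rw [Function.update_self]; exact hord idx l h5 hl1 hl2
    · rw [hu _ _ _ hqQ] at hq ⊢
      exact h9 q hq1 hqQ hq l hl1 hl2
  refine ⟨fun hwr => ?_, fun hrw => ?_⟩
  · refine ⟨hsys w hw.le hwr, hold w, fun l hl1 hl2 hl3 => ?_, fun hl => ?_, fun l hl1 hl2 => ?_,
      by omega, fun hl => ?_, fun hl => ?_, .inr (hslot w hwr),
      fun q hq1 hq2 hq l hl1 hl2 => horder q hq1 hq2 hq l (by omega) hl2⟩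
    · by_cases hl : l = idx
      · rw [hl, hself]; ring
      · rw [hothers w l hl1 hl3 hl]; exact h2 l hl1 (by omega) hl3
    · rw [hothers w _ (by omega) hl (by omega), h4 _ (by omega) hl]; ring
    · rw [hothers w _ (by omega) hl2 (by omega), h4 _ (by omega) hl2]
    · have := hI.eps_pos
      have := (hH _ (by omega) hl).2.1
      positivity
    · have c2 := hI.x_le_one (hH _ (by omega) hl).1
      have c3 := (hH _ (by omega) hl).2.1
      have := hI.eps_pos
      have := hI.eps_le
      nlinarith
  · refine ⟨hsys r hr.le le_rfl, hold r, fun l hl1 hl2 hl3 => ?_, fun hl => ?_, fun l hl1 hl2 => ?_,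
      h5, fun hl => by linarith, fun hl => by linarith [h7 hl], .inr (hslot r le_rfl), horder⟩
    · rw [hothers r l hl1 hl3 (by omega)]; exact h2 l hl1 hl2 hl3
    · rw [hself]; ring
    · rw [hothers r _ (by omega) hl2 (by omega), h4 _ hl1 hl2]

theorem Emitting.finish (h : Emitting N mc p x ε D i d H Q T pe ps y mach fs idx w r)
    (hd : d < idx) (hH : ∀ e < N, 0 < x e → mc e = i → ∃ l, 1 ≤ l ∧ l ≤ d ∧ H l = e) :
    ∀ e < N, 0 < x e → D (mc e) ∨ mc e = i → fiberSum Q pe y e = (1 + ε) * x e := by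
  rintro e he hx (hD | hi)
  · exact h.sum_old e he hx hD
  · obtain ⟨l, hl1, hl2, rfl⟩ := hH e he hx hi
    exact h.sum_lt l hl1 (by omega) hl2

end

/-- An upper bound for the number of pairs that are still to be constructed for a machine. -/
noncomputable def emitPotential (d idx : ℕ) (w r : ℝ) : ℕ :=
  if idx ≤ d then 6 * (d - idx) + 2 * ⌈w⌉₊ + (if r ≤ 0 then 0 else 1) else 0

/-- A scaled weight is at most 2, so the current edge contributes at most 4 + 1 units, less than the
6 reserved for each later edge. -/
theorem emitPotential_le {d idx : ℕ} {w r : ℝ} (hw : idx ≤ d → w ≤ 2) :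
    emitPotential d idx w r ≤ 6 * (d + 1 - idx) := by
  unfold emitPotential
  split_ifs with h1 h2
  · have : ⌈w⌉₊ ≤ 2 := Nat.ceil_le.2 (by exact_mod_cast hw h1)
    omega
  · have : ⌈w⌉₊ ≤ 2 := Nat.ceil_le.2 (by exact_mod_cast hw h1)
    omega
  · omega

theorem emitPotential_next {d idx : ℕ} {w r w' r' : ℝ} (hd : idx ≤ d) (hw : 0 < w)
    (hw' : idx + 1 ≤ d → w' ≤ 2) :
    emitPotential d (idx + 1) w' r' + 1 ≤ emitPotential d idx w r := by
  have h1 := emitPotential_le (r := r') hw'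
  have h2 : 1 ≤ ⌈w⌉₊ := Nat.one_le_ceil_iff.2 hw
  have h3 : 6 * (d - idx) + 2 * ⌈w⌉₊ ≤ emitPotential d idx w r := by
    simp [emitPotential, hd]
  have : d + 1 - (idx + 1) = d - idx := by omega
  rw [this] at h1
  omega

/-- A newly opened slot swallows a full unit of the edge, so the ceiling drops by 1. In an older
slot the remaining capacity becomes 0, and the last summand drops instead. -/
theorem emitPotential_split {d idx : ℕ} {w r r₁ : ℝ} (hd : idx ≤ d) (h1 : r ≤ 0 → r₁ = 1)
    (h2 : 0 < r → r₁ = r) (hrw : r₁ < w) :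
    emitPotential d idx (w - r₁) (r₁ - r₁) + 1 ≤ emitPotential d idx w r := by
  simp only [emitPotential, hd, if_true, sub_self, le_refl]
  by_cases hr : r ≤ 0
  · rw [if_pos hr, h1 hr]
    have := Nat.ceil_sub_one w
    rw [this]
    have : 1 ≤ ⌈w⌉₊ := Nat.one_le_ceil_iff.2 (by rw [h1 hr] at hrw; linarith)
    omega
  · rw [if_neg hr, h2 (not_le.1 hr)]
    have : ⌈w - r⌉₊ ≤ ⌈w⌉₊ := Nat.ceil_le_ceil (by linarith)
    omega

/-! ### The program that fills the slots of one machine -/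

/-- The memory holds the scheduling instance. -/
structure HoldsInstance (n N : ℕ) (job mc : ℕ → ℕ) (p x : ℕ → ℝ) (ε : ℝ) (s : Memory) : Prop where
  jobs : s.nat 0 0 = n
  edges : s.nat 0 2 = N
  job : s.nat 1 = job
  mc : s.nat 2 = mc
  eps : s.real 0 0 = ε
  time : s.real 1 = p
  frac : s.real 2 = x

theorem HoldsInstance.frame {n N : ℕ} {job mc : ℕ → ℕ} {p x : ℕ → ℝ} {ε : ℝ} {s s' : Memory}
    {P : Program} (h : HoldsInstance n N job mc p x ε s) (hF : Frame P s s')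
    (hn : ∀ a ≤ 2, a ∉ P.natWrites) (hr : ∀ a ≤ 2, a ∉ P.realWrites) :
    HoldsInstance n N job mc p x ε s' := by
  have e0 := hF.nat 0 (hn 0 (by omega))
  have e1 := hF.nat 1 (hn 1 (by omega))
  have e2 := hF.nat 2 (hn 2 (by omega))
  have r0 := hF.real 0 (hr 0 (by omega))
  have r1 := hF.real 1 (hr 1 (by omega))
  have r2 := hF.real 2 (hr 2 (by omega))
  exact ⟨by rw [e0, h.jobs], by rw [e0, h.edges], by rw [e1, h.job], by rw [e2, h.mc],
    by rw [r0, h.eps], by rw [r1, h.time], by rw [r2, h.frac]⟩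

/-- The machine of the current edge. -/
abbrev curMachine : NatExpr := .get 2 (.var 7)

/-- The weight of the edge at the position `idx` of the sorted list. -/
abbrev curWeight : RealExpr :=
  .mul (.add (.const 1) (.var 0)) (.get 2 (.get 6 (.var 23)))

/-- A new slot is opened if the last one is full. -/
def openSlot : Program :=
  .branch (.realLE (.var 5) (.const 0))
    (.seq (.setNat 16 (.const 0) (.add (.var 16) (.const 1)))
      (.seq (.setNat 19 (.var 16) curMachine) (.setReal 5 (.const 0) (.const 1)))) .skip

/-- As much as possible of the current edge is put into the last slot. -/
def appendPair : Program :=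
  .seq (.branch (.realLE (.var 4) (.var 5)) (.setReal 6 (.const 0) (.var 4))
      (.setReal 6 (.const 0) (.var 5)))
    (.seq (.setNat 15 (.const 0) (.add (.var 15) (.const 1)))
    (.seq (.setNat 17 (.var 15) (.get 6 (.var 23)))
    (.seq (.setNat 18 (.var 15) (.var 16))
    (.seq (.setReal 3 (.var 15) (.var 6))
    (.seq (.setReal 4 (.const 0) (.sub (.var 4) (.var 6)))
    (.seq (.setReal 5 (.const 0) (.sub (.var 5) (.var 6)))
    (.branch (.realLE (.var 4) (.const 0))
      (.seq (.setNat 23 (.const 0) (.add (.var 23) (.const 1)))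
        (.setReal 4 (.const 0) curWeight)) .skip)))))))

/-- Initialization of the construction of the slots of a machine. -/
def emitInit : Program :=
  .seq (.setNat 20 curMachine (.add (.var 16) (.const 1)))
    (.seq (.setNat 23 (.const 0) (.const 1))
    (.seq (.setReal 5 (.const 0) (.const 0)) (.setReal 4 (.const 0) curWeight)))

/-- Construction of the slots of a machine whose edges are sorted in the array `6`. -/
def emit : Program :=
  .seq emitInit (.loop (.natLE (.var 23) (.var 8)) (.seq openSlot appendPair))

/-- The slot system that is held by the memory. -/
abbrev HasSlots (N : ℕ) (mc : ℕ → ℕ) (p x : ℕ → ℝ) (D : ℕ → Prop) (s : Memory) : Prop :=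
  SlotSystem N mc p x D (s.nat 15 0) (s.nat 16 0) (s.nat 17) (s.nat 18) (s.real 3) (s.nat 19)
    (s.nat 20)

/-- The edges of the machines in `D` are completely distributed. -/
abbrev HasSums (N : ℕ) (mc : ℕ → ℕ) (x : ℕ → ℝ) (ε : ℝ) (D : ℕ → Prop) (s : Memory) : Prop :=
  ∀ e < N, 0 < x e → D (mc e) → fiberSum (s.nat 15 0) (s.nat 17) (s.real 3) e = (1 + ε) * x e

/-- The invariant of `emit` for the data held by the memory. -/
abbrev EmittingAt (N : ℕ) (mc : ℕ → ℕ) (p x : ℕ → ℝ) (ε : ℝ) (D : ℕ → Prop) (i d : ℕ) (H : ℕ → ℕ)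
    (s : Memory) : Prop :=
  Emitting N mc p x ε D i d H (s.nat 15 0) (s.nat 16 0) (s.nat 17) (s.nat 18) (s.real 3) (s.nat 19)
    (s.nat 20) (s.nat 23 0) (s.real 4 0) (s.real 5 0)

theorem openSlot_run {n N : ℕ} {job mc : ℕ → ℕ} {p x : ℕ → ℝ} {ε : ℝ} {D : ℕ → Prop} {d : ℕ}
    {H : ℕ → ℕ} {s : Memory} (hs : HoldsInstance n N job mc p x ε s)
    (h : EmittingAt N mc p x ε D (mc (s.nat 7 0)) d H s) :
    EmittingAt N mc p x ε D (mc (s.nat 7 0)) d H (openSlot.run s) ∧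
      (openSlot.run s).nat 15 0 = s.nat 15 0 ∧ (openSlot.run s).nat 23 0 = s.nat 23 0 ∧
      (openSlot.run s).real 4 0 = s.real 4 0 ∧
      (s.real 5 0 ≤ 0 → (openSlot.run s).real 5 0 = 1) ∧
      (0 < s.real 5 0 → (openSlot.run s).real 5 0 = s.real 5 0) := by
  by_cases hr : s.real 5 0 ≤ 0
  · refine ⟨?_, ?_⟩
    · have := h.open_slot hr
      simpa [EmittingAt, openSlot, Program.run, Test.Holds, NatExpr.eval, RealExpr.eval, hr,
        Memory.writeNat_nat, Memory.writeReal_nat, Memory.writeNat_real, Memory.writeReal_real,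
        hs.mc] using this
    · simp [openSlot, Program.run, Test.Holds, NatExpr.eval, RealExpr.eval, hr,
        Memory.writeNat_nat, Memory.writeReal_nat, Memory.writeNat_real, Memory.writeReal_real]
  · have : openSlot.run s = s := by
      simp [openSlot, Program.run, Test.Holds, NatExpr.eval, RealExpr.eval, hr]
    rw [this]
    exact ⟨h, rfl, rfl, rfl, fun h => absurd h hr, fun _ => rfl⟩

theorem appendPair_run {n N : ℕ} {job mc : ℕ → ℕ} {p x : ℕ → ℝ} {ε : ℝ} {D : ℕ → Prop} {i d : ℕ}
    {H : ℕ → ℕ} {s : Memory} (hI : EdgeList n N job mc p x ε)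
    (hs : HoldsInstance n N job mc p x ε s) (h6 : s.nat 6 = H)
    (h : EmittingAt N mc p x ε D i d H s) (hr : 0 < s.real 5 0) (hd : s.nat 23 0 ≤ d)
    (hi : ¬ D i) (hH : ∀ l, 1 ≤ l → l ≤ d → H l < N ∧ 0 < x (H l) ∧ mc (H l) = i)
    (hinj : Set.InjOn H (Set.Icc 1 d))
    (hord : ∀ k l, 1 ≤ k → k ≤ l → l ≤ d → p (H l) ≤ p (H k)) :
    EmittingAt N mc p x ε D i d H (appendPair.run s) ∧
      (appendPair.run s).nat 15 0 = s.nat 15 0 + 1 ∧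
      ((appendPair.run s).nat 23 0 = s.nat 23 0 + 1 ∨
        (s.real 5 0 < s.real 4 0 ∧ (appendPair.run s).nat 23 0 = s.nat 23 0 ∧
          (appendPair.run s).real 4 0 = s.real 4 0 - s.real 5 0 ∧
          (appendPair.run s).real 5 0 = s.real 5 0 - s.real 5 0)) := by
  obtain ⟨g1, g2⟩ := h.append hI hr hd hi hH hinj hord
  by_cases hw : s.real 4 0 ≤ s.real 5 0
  · refine ⟨?_, ?_⟩
    · have := g1 hw
      simpa [EmittingAt, appendPair, Program.run, Test.Holds, NatExpr.eval, RealExpr.eval, hw,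
        Memory.writeNat_nat, Memory.writeReal_nat, Memory.writeNat_real, Memory.writeReal_real,
        hs.frac, hs.eps, h6] using this
    · simp [appendPair, Program.run, Test.Holds, NatExpr.eval, RealExpr.eval, hw,
        Memory.writeNat_nat, Memory.writeReal_nat, Memory.writeNat_real, Memory.writeReal_real]
  · refine ⟨?_, ?_⟩
    · have := g2 (not_le.1 hw)
      simpa [EmittingAt, appendPair, Program.run, Test.Holds, NatExpr.eval, RealExpr.eval, hw,
        Memory.writeNat_nat, Memory.writeReal_nat, Memory.writeNat_real, Memory.writeReal_real,
        hs.frac, hs.eps, h6] using this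
    · simp [appendPair, Program.run, Test.Holds, NatExpr.eval, RealExpr.eval, hw,
        Memory.writeNat_nat, Memory.writeReal_nat, Memory.writeNat_real, Memory.writeReal_real]
      exact not_le.1 hw

/-- Every iteration appends exactly one pair and lowers `emitPotential` by at least 1. The same
potential therefore bounds the running time and the number of new pairs. -/
theorem emit_ends {n N : ℕ} {job mc : ℕ → ℕ} {p x : ℕ → ℝ} {ε : ℝ} {D : ℕ → Prop} {i d : ℕ}
    {H : ℕ → ℕ} {s : Memory} (hI : EdgeList n N job mc p x ε)
    (hs : HoldsInstance n N job mc p x ε s) (h6 : s.nat 6 = H) (h8 : s.nat 8 0 = d)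
    (h7 : mc (s.nat 7 0) = i)
    (hslots : HasSlots N mc p x D s) (hsums : HasSums N mc x ε D s)
    (hi : ¬ D i) (hH : ∀ l, 1 ≤ l → l ≤ d → H l < N ∧ 0 < x (H l) ∧ mc (H l) = i)
    (hinj : Set.InjOn H (Set.Icc 1 d))
    (hord : ∀ k l, 1 ≤ k → k ≤ l → l ≤ d → p (H l) ≤ p (H k))
    (hall : ∀ e < N, 0 < x e → mc e = i → ∃ l, 1 ≤ l ∧ l ≤ d ∧ H l = e) :
    Ends emit s (1200 * (d + 1)) fun s' =>
      HasSlots N mc p x (fun k => D k ∨ k = i) s' ∧ HasSums N mc x ε (fun k => D k ∨ k = i) s' ∧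
      s'.nat 15 0 ≤ s.nat 15 0 + 6 * d := by
  refine (Ends.run_seq (B := 100) (B' := 1200 * d + 50)
    (by simp [emitInit, Program.LoopFree]) (by decide) ?_).mono (by omega) fun _ _ h => h
  have hF0 : Frame emitInit s (emitInit.run s) := by
    obtain ⟨t, -, ht⟩ := Program.LoopFree.runs (P := emitInit) (by simp [emitInit, Program.LoopFree]) s
    exact ht.frame
  have hI0 : EmittingAt N mc p x ε D i d H (emitInit.run s) := by
    have := Emitting.start hI hslots hsums hi hH
    simpa [EmittingAt, emitInit, Program.run, NatExpr.eval, RealExpr.eval,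
        Memory.writeNat_nat, Memory.writeReal_nat, Memory.writeNat_real, Memory.writeReal_real,
        hs.frac, hs.eps, h6, h7, hs.mc] using this
  have h23 : (emitInit.run s).nat 23 0 = 1 := by
    simp [emitInit, Program.run, NatExpr.eval, Memory.writeNat_nat, Memory.writeReal_nat]
  have h15 : (emitInit.run s).nat 15 0 = s.nat 15 0 := by
    simp [emitInit, Program.run, NatExpr.eval, Memory.writeNat_nat, Memory.writeReal_nat]
  have hs0 := hs.frame hF0 (by decide) (by decide)
  have e6 := (hF0.nat 6 (by decide)).trans h6
  have e7 : mc ((emitInit.run s).nat 7 0) = i := by rw [hF0.nat 7 (by decide), h7]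
  have e8 : (emitInit.run s).nat 8 0 = d := by rw [hF0.nat 8 (by decide), h8]
  generalize emitInit.run s = s0 at *
  refine (Ends.loop (I := fun t => EmittingAt N mc p x ε D i d H t ∧
      t.nat 15 0 + emitPotential d (t.nat 23 0) (t.real 4 0) (t.real 5 0) ≤ s.nat 15 0 + 6 * d)
    (φ := fun t => 200 * emitPotential d (t.nat 23 0) (t.real 4 0) (t.real 5 0))
    ⟨hI0, ?_⟩ ?_).mono ?_ ?_
  · have := emitPotential_le (r := s0.real 5 0) hI0.w_le
    rw [h23] at this ⊢
    rw [h15]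
    simpa using this
  · rintro t hF ⟨hE, hc⟩ hb
    simp only [Test.Holds, NatExpr.eval, hF.nat 8 (by decide), e8] at hb
    have hst := hs0.frame hF (by decide) (by decide)
    have t6 := (hF.nat 6 (by decide)).trans e6
    have t7 : mc (t.nat 7 0) = i := by rw [hF.nat 7 (by decide), e7]
    refine ⟨180, .of_loopFree (by simp [openSlot, appendPair, Program.LoopFree]) (by decide) ?_⟩
    have hF1 : Frame openSlot t (openSlot.run t) := by
      obtain ⟨t, -, ht⟩ := Program.LoopFree.runs (P := openSlot)
        (by simp [openSlot, Program.LoopFree]) t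
      exact ht.frame
    obtain ⟨a1, a2, a3, a4, a5, a6⟩ := openSlot_run hst (by rw [t7]; exact hE)
    rw [t7] at a1
    have hst1 := hst.frame hF1 (by decide) (by decide)
    have t16 := (hF1.nat 6 (by decide)).trans t6
    simp only [Program.run]
    generalize openSlot.run t = t1 at *
    have hr : 0 < t1.real 5 0 := by
      by_cases hr : t.real 5 0 ≤ 0
      · rw [a5 hr]; exact one_pos
      · rw [a6 (not_le.1 hr)]; exact not_le.1 hr
    obtain ⟨b1, b2, b3⟩ := appendPair_run hI hst1 t16 a1 hr (by omega) hi hH hinj hord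
    have key : emitPotential d ((appendPair.run t1).nat 23 0) ((appendPair.run t1).real 4 0)
        ((appendPair.run t1).real 5 0) + 1 ≤
          emitPotential d (t.nat 23 0) (t.real 4 0) (t.real 5 0) := by
      rcases b3 with b3 | ⟨c0, c1, c2, c3⟩
      · have hwle := b1.w_le
        rw [b3, a3] at hwle ⊢
        exact emitPotential_next hb (hE.w_pos hb) hwle
      · rw [c1, c2, c3, a3, a4]
        exact emitPotential_split hb a5 a6 (by rw [← a4]; exact c0)
    refine ⟨⟨b1, by omega⟩, ?_⟩
    simp only [Test.cost, NatExpr.cost]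
    omega
  · have := emitPotential_le (r := s0.real 5 0) hI0.w_le
    rw [h23] at this ⊢
    simp only [Test.cost, NatExpr.cost]
    omega
  · rintro t hF ⟨⟨hE, hc⟩, hb⟩
    simp only [Test.Holds, NatExpr.eval, hF.nat 8 (by decide), e8] at hb
    exact ⟨hE.sys, hE.finish (by omega) hall, by omega⟩

/-! ### Loading and sorting the edges of one machine -/

/-- The last of the edges `0, …, N - 1` at the machine `k`, counted from `1`. -/
def lastEdge (N : ℕ) (mc : ℕ → ℕ) (k : ℕ) : ℕ := Nat.findGreatest (fun q => mc (q - 1) = k) N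

/-- The number of the edges at a machine. -/
def degree (N : ℕ) (mc : ℕ → ℕ) (i : ℕ) : ℕ := ((Finset.range N).filter fun f => mc f = i).card

/-- The memory holds the lists of the edges at the machines. -/
structure HasLists (N : ℕ) (mc : ℕ → ℕ) (s : Memory) : Prop where
  head : ∀ k, s.nat 4 k = lastEdge N mc k
  next : ∀ q, 1 ≤ q → q ≤ N →
    s.nat 5 q = Nat.findGreatest (fun q' => mc (q' - 1) = mc (q - 1)) (q - 1)

/-- The list `H 1, …, H d` contains the edges of positive weight at the machine `i`. -/
structure Enumerates (N : ℕ) (mc : ℕ → ℕ) (x : ℕ → ℝ) (i d : ℕ) (H : ℕ → ℕ) : Prop where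
  mem : ∀ l, 1 ≤ l → l ≤ d → H l < N ∧ 0 < x (H l) ∧ mc (H l) = i
  inj : Set.InjOn H (Set.Icc 1 d)
  exists_eq : ∀ e < N, 0 < x e → mc e = i → ∃ l, 1 ≤ l ∧ l ≤ d ∧ H l = e

theorem Enumerates.rearranged {N : ℕ} {mc : ℕ → ℕ} {x : ℕ → ℝ} {i d : ℕ} {H H' : ℕ → ℕ}
    (h : Enumerates N mc x i d H) (hR : Rearranged 1 d H H') : Enumerates N mc x i d H' := by
  refine ⟨fun l h1 h2 => ?_, hR.injOn h.inj, fun e he hx hm => ?_⟩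
  · obtain ⟨j, h3, h4, h5⟩ := hR.exists_mem l h1 h2
    rw [h5]; exact h.mem j h3 h4
  · obtain ⟨l, h1, h2, rfl⟩ := h.exists_eq e he hx hm
    obtain ⟨j, h3, h4, h5⟩ := hR.symm.exists_mem l h1 h2
    exact ⟨j, h3, h4, h5.symm⟩

theorem Enumerates.le_degree {N : ℕ} {mc : ℕ → ℕ} {x : ℕ → ℝ} {i d : ℕ} {H : ℕ → ℕ}
    (h : Enumerates N mc x i d H) : d ≤ degree N mc i := by
  have := Finset.card_le_card_of_injOn (s := Finset.Icc 1 d)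
    (t := (Finset.range N).filter fun f => mc f = i) H
    (fun l hl => by
      have hl := Finset.mem_Icc.1 hl
      obtain ⟨h1, -, h3⟩ := h.mem l hl.1 hl.2
      exact Finset.mem_coe.2 (Finset.mem_filter.2 ⟨Finset.mem_range.2 h1, h3⟩))
    (by rw [Finset.coe_Icc]; exact h.inj)
  simpa [degree] using this

/-- Edges at one machine belong to different jobs. This makes the sorting time logarithmic in the
number of jobs rather than in the number of edges. -/
theorem Enumerates.le_jobs {n N : ℕ} {job mc : ℕ → ℕ} {p x : ℕ → ℝ} {ε : ℝ} {i d : ℕ} {H : ℕ → ℕ}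
    (h : Enumerates N mc x i d H) (hI : EdgeList n N job mc p x ε) : d ≤ n := by
  have := Finset.card_le_card_of_injOn (s := Finset.Icc 1 d) (t := Finset.range n)
    (fun l => job (H l))
    (fun l hl => by
      have hl := Finset.mem_Icc.1 hl
      exact Finset.mem_coe.2 (Finset.mem_range.2 (hI.job_lt _ (h.mem l hl.1 hl.2).1)))
    (fun l hl l' hl' hll => by
      rw [Finset.coe_Icc] at hl hl'
      have a := h.mem l hl.1 hl.2
      have b := h.mem l' hl'.1 hl'.2
      exact h.inj hl hl' (hI.inj _ a.1 _ b.1 hll (a.2.2.trans b.2.2.symm)))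
  simpa [degree] using this

/-- An edge of positive weight is added to the list in the array `6`. -/
def loadBody : Program :=
  .seq (.branch (.realLE (.get 2 (.sub (.var 9) (.const 1))) (.const 0)) .skip
    (.seq (.setNat 8 (.const 0) (.add (.var 8) (.const 1)))
      (.setNat 6 (.var 8) (.sub (.var 9) (.const 1)))))
    (.setNat 9 (.const 0) (.get 5 (.var 9)))

/-- The edges of positive weight at the current machine are listed in the array `6`. -/
def loadMachine : Program :=
  .seq (.seq (.setNat 8 (.const 0) (.const 0)) (.setNat 9 (.const 0) (.add (.var 7) (.const 1))))
    (.loop (.natLE (.const 1) (.var 9)) loadBody)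

theorem loadMachine_ends {n N : ℕ} {job mc : ℕ → ℕ} {p x : ℕ → ℝ} {ε : ℝ} {e : ℕ} {s : Memory}
    (hs : HoldsInstance n N job mc p x ε s) (hL : HasLists N mc s) (he : s.nat 7 0 = e)
    (heN : e < N) (hlast : lastEdge N mc (mc e) = e + 1) :
    Ends loadMachine s (50 * (degree N mc (mc e) + 1)) fun s' =>
      Enumerates N mc x (mc e) (s'.nat 8 0) (s'.nat 6) := by
  refine (Ends.run_seq (B := 12) (B' := 38 * degree N mc (mc e) + 4)
    (by simp [Program.LoopFree]) (by decide) ?_).mono (by omega) fun _ _ h => h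
  set s0 := Program.run _ s with hs0
  have h2 : s0.real 2 = x := by simp [hs0, Program.run, Memory.writeNat_real, hs.frac]
  have h5 : s0.nat 5 = s.nat 5 := by simp [hs0, Program.run, Memory.writeNat_nat]
  have h8 : s0.nat 8 0 = 0 := by simp [hs0, Program.run, Memory.writeNat_nat, NatExpr.eval]
  have h9 : s0.nat 9 0 = e + 1 := by
    simp [hs0, Program.run, Memory.writeNat_nat, NatExpr.eval, he]
  clear_value s0
  set i := mc e with hi
  -- A nonzero pointer `v` stands for the edge `v - 1`, so every edge already stored is at least
  -- `v`, and the next one differs from all of them. The potential counts the edges of the machine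
  -- below the pointer.
  refine (Ends.loop (I := fun t => t.nat 9 0 ≤ N ∧ (t.nat 9 0 ≠ 0 → mc (t.nat 9 0 - 1) = i) ∧
      (∀ l, 1 ≤ l → l ≤ t.nat 8 0 → t.nat 9 0 ≤ t.nat 6 l) ∧
      (∀ l, 1 ≤ l → l ≤ t.nat 8 0 → t.nat 6 l < N ∧ 0 < x (t.nat 6 l) ∧ mc (t.nat 6 l) = i) ∧
      Set.InjOn (t.nat 6) (Set.Icc 1 (t.nat 8 0)) ∧
      ∀ f < N, t.nat 9 0 ≤ f → 0 < x f → mc f = i → ∃ l, 1 ≤ l ∧ l ≤ t.nat 8 0 ∧ t.nat 6 l = f)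
    (φ := fun t => 38 * degree (t.nat 9 0) mc i) ?_ ?_).mono ?_ ?_
  · rw [h8, h9]
    refine ⟨heN, fun _ => by simp [hi], fun l _ _ => by omega, fun l _ _ => by omega, ?_, ?_⟩
    · intro l hl; simp only [Set.mem_Icc] at hl; omega
    · intro f hf hef hx hm
      refine absurd (show mc (f + 1 - 1) = i by simpa using hm) ?_
      refine Nat.findGreatest_is_greatest (P := fun q => mc (q - 1) = i) (n := N) ?_ hf
      have : Nat.findGreatest (fun q => mc (q - 1) = i) N = e + 1 := hlast
      omega
  · rintro t hF ⟨a1, a2, a3, a4, a5, a6⟩ hb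
    simp only [Test.Holds, NatExpr.eval] at hb
    have hr2 := (hF.real 2 (by decide)).trans h2
    have t5 := (hF.nat 5 (by decide)).trans h5
    have hnext := hL.next _ hb a1
    rw [← t5, a2 (by omega)] at hnext
    have hlt : t.nat 5 (t.nat 9 0) ≤ t.nat 9 0 - 1 := by rw [hnext]; exact Nat.findGreatest_le _
    have hmc : t.nat 5 (t.nat 9 0) ≠ 0 → mc (t.nat 5 (t.nat 9 0) - 1) = i := by
      intro h0
      exact Nat.findGreatest_of_ne_zero (P := fun q' => mc (q' - 1) = i) hnext.symm h0
    have hgap : ∀ f, t.nat 5 (t.nat 9 0) ≤ f → f < t.nat 9 0 → mc f = i → f = t.nat 9 0 - 1 := by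
      intro f h1 h2 h3
      by_contra h4
      refine absurd (show mc (f + 1 - 1) = i by simpa using h3) ?_
      refine Nat.findGreatest_is_greatest (P := fun q => mc (q - 1) = i) (n := t.nat 9 0 - 1) ?_
        (by omega)
      rw [← hnext]; omega
    have hdeg : degree (t.nat 5 (t.nat 9 0)) mc i + 1 ≤ degree (t.nat 9 0) mc i := by
      have hns : t.nat 9 0 - 1 ∉ (Finset.range (t.nat 5 (t.nat 9 0))).filter fun f => mc f = i := by
        simp only [Finset.mem_filter, Finset.mem_range]; omega
      unfold degree
      rw [← Finset.card_insert_of_notMem hns]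
      refine Finset.card_le_card fun f hf => ?_
      simp only [Finset.mem_insert, Finset.mem_filter, Finset.mem_range] at hf ⊢
      rcases hf with rfl | hf
      · exact ⟨by omega, a2 (by omega)⟩
      · exact ⟨by omega, hf.2⟩
    refine ⟨34, .of_loopFree (by simp [loadBody, Program.LoopFree]) (by decide) ?_⟩
    simp only [Test.cost, NatExpr.cost]
    set v := t.nat 9 0 with hv
    by_cases hx : x (v - 1) ≤ 0
    · have r6 : (loadBody.run t).nat 6 = t.nat 6 := by
        simp [loadBody, Program.run, Test.Holds, NatExpr.eval, RealExpr.eval, hr2, ← hv, hx,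
          Memory.writeNat_nat]
      have r8 : (loadBody.run t).nat 8 0 = t.nat 8 0 := by
        simp [loadBody, Program.run, Test.Holds, NatExpr.eval, RealExpr.eval, hr2, ← hv, hx,
          Memory.writeNat_nat]
      have r9 : (loadBody.run t).nat 9 0 = t.nat 5 v := by
        simp [loadBody, Program.run, Test.Holds, NatExpr.eval, RealExpr.eval, hr2, ← hv, hx,
          Memory.writeNat_nat]
      rw [r6, r8, r9]
      refine ⟨⟨by omega, hmc, fun l hl1 hl2 => (a3 l hl1 hl2).trans' (by omega), a4, a5,
        fun f hf hvf hxf hmf => ?_⟩, by omega⟩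
      by_cases hfv : v ≤ f
      · exact a6 f hf hfv hxf hmf
      · rw [hgap f hvf (by omega) hmf] at hxf
        exact absurd hxf (not_lt.2 hx)
    · have r6 : (loadBody.run t).nat 6 = Function.update (t.nat 6) (t.nat 8 0 + 1) (v - 1) := by
        simp [loadBody, Program.run, Test.Holds, NatExpr.eval, RealExpr.eval, hr2, ← hv, hx,
          Memory.writeNat_nat]
      have r8 : (loadBody.run t).nat 8 0 = t.nat 8 0 + 1 := by
        simp [loadBody, Program.run, Test.Holds, NatExpr.eval, RealExpr.eval, hr2, ← hv, hx,
          Memory.writeNat_nat]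
      have r9 : (loadBody.run t).nat 9 0 = t.nat 5 v := by
        simp [loadBody, Program.run, Test.Holds, NatExpr.eval, RealExpr.eval, hr2, ← hv, hx,
          Memory.writeNat_nat]
      have hu : ∀ l, l ≤ t.nat 8 0 →
          Function.update (t.nat 6) (t.nat 8 0 + 1) (v - 1) l = t.nat 6 l :=
        fun l hl => Function.update_of_ne (by omega) _ _
      rw [r6, r8, r9]
      have split : ∀ l, l ≤ t.nat 8 0 + 1 → l = t.nat 8 0 + 1 ∨ l ≤ t.nat 8 0 := by omega
      refine ⟨⟨by omega, hmc, fun l hl1 hl2 => ?_, fun l hl1 hl2 => ?_, ?_,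
        fun f hf hvf hxf hmf => ?_⟩, by omega⟩
      · rcases split l hl2 with rfl | hl
        · simpa using hlt
        · rw [hu l hl]; exact (a3 l hl1 hl).trans' (by omega)
      · rcases split l hl2 with rfl | hl
        · rw [Function.update_self]
          exact ⟨by omega, not_le.1 hx, a2 (by omega)⟩
        · rw [hu l hl]; exact a4 l hl1 hl
      · intro l hl l' hl' hll
        rcases split l hl.2 with h1 | h1 <;> rcases split l' hl'.2 with h2 | h2
        · rw [h1, h2]
        · rw [h1, Function.update_self, hu l' h2] at hll
          have := a3 l' hl'.1 h2; omega
        · rw [h2, Function.update_self, hu l h1] at hll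
          have := a3 l hl.1 h1; omega
        · rw [hu l h1, hu l' h2] at hll
          exact a5 ⟨hl.1, h1⟩ ⟨hl'.1, h2⟩ hll
      · by_cases hfv : v ≤ f
        · obtain ⟨l, hl1, hl2, hl3⟩ := a6 f hf hfv hxf hmf
          exact ⟨l, hl1, by omega, by rw [hu l hl2, hl3]⟩
        · exact ⟨t.nat 8 0 + 1, by omega, le_rfl, by
            rw [Function.update_self, hgap f hvf (by omega) hmf]⟩
  · have : degree (s0.nat 9 0) mc i ≤ degree N mc i :=
      Finset.card_le_card (Finset.filter_subset_filter _ (Finset.range_subset_range.2 (by omega)))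
    simp only [Test.cost, NatExpr.cost]
    omega
  · rintro t hF ⟨⟨a1, a2, a3, a4, a5, a6⟩, hb⟩
    simp only [Test.Holds, NatExpr.eval] at hb
    exact ⟨a4, a5, fun f hf hx hm => a6 f hf (by omega) hx hm⟩

/-- Construction of the slots of the current machine. -/
def processMachine : Program := .seq loadMachine (.seq heapSort emit)

theorem processMachine_ends {n N : ℕ} {job mc : ℕ → ℕ} {p x : ℕ → ℝ} {ε : ℝ} {e K : ℕ} {s : Memory}
    {D : ℕ → Prop} (hI : EdgeList n N job mc p x ε)
    (hs : HoldsInstance n N job mc p x ε s) (hL : HasLists N mc s) (he : s.nat 7 0 = e)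
    (heN : e < N) (hlast : lastEdge N mc (mc e) = e + 1) (hK : n < 2 ^ K)
    (hslots : HasSlots N mc p x D s) (hsums : HasSums N mc x ε D s) (hi : ¬ D (mc e)) :
    Ends processMachine s (4000 * (K + 1) * degree N mc (mc e)) fun s' =>
      HasSlots N mc p x (fun k => D k ∨ k = mc e) s' ∧
      HasSums N mc x ε (fun k => D k ∨ k = mc e) s' ∧
      s'.nat 15 0 ≤ s.nat 15 0 + 6 * degree N mc (mc e) := by
  -- The machine has at least one edge, so costs proportional to `δ + 1` are absorbed by a multiple
  -- of `δ`.
  have hdeg : 1 ≤ degree N mc (mc e) :=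
    Finset.card_pos.2 ⟨e, Finset.mem_filter.2 ⟨Finset.mem_range.2 heN, rfl⟩⟩
  set δ := degree N mc (mc e) with hδ
  refine ((loadMachine_ends hs hL he heN hlast).seq (B' := 400 * (K + 1) * (δ + 1) + 1200 * (δ + 1))
    (R' := fun s' => HasSlots N mc p x (fun k => D k ∨ k = mc e) s' ∧
      HasSums N mc x ε (fun k => D k ∨ k = mc e) s' ∧
      s'.nat 15 0 ≤ s.nat 15 0 + 6 * δ) fun s1 hF1 h1 => ?_).mono ?_ fun _ _ h => h
  · have hs1 := hs.frame hF1 (by decide) (by decide)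
    have hd := h1.le_degree
    have hdn := h1.le_jobs hI
    refine (((heapSort_ends s1 (K := K) hs1.time rfl (hdn.trans_lt hK)).mono (B' :=
      400 * (K + 1) * (δ + 1)) (by gcongr) fun _ _ h => h)).seq fun s2 hF2 h2 => ?_
    have hs2 := hs1.frame hF2 (by decide) (by decide)
    have hen := h1.rearranged h2.1
    have e8 := congrFun (hF2.nat 8 (by decide)) 0
    have e7 : s2.nat 7 0 = e := by rw [hF2.nat 7 (by decide), hF1.nat 7 (by decide), he]
    have e15 : s2.nat 15 = s.nat 15 := by rw [hF2.nat 15 (by decide), hF1.nat 15 (by decide)]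
    have e16 : s2.nat 16 = s.nat 16 := by rw [hF2.nat 16 (by decide), hF1.nat 16 (by decide)]
    have e17 : s2.nat 17 = s.nat 17 := by rw [hF2.nat 17 (by decide), hF1.nat 17 (by decide)]
    have e18 : s2.nat 18 = s.nat 18 := by rw [hF2.nat 18 (by decide), hF1.nat 18 (by decide)]
    have e19 : s2.nat 19 = s.nat 19 := by rw [hF2.nat 19 (by decide), hF1.nat 19 (by decide)]
    have e20 : s2.nat 20 = s.nat 20 := by rw [hF2.nat 20 (by decide), hF1.nat 20 (by decide)]
    have r3 : s2.real 3 = s.real 3 := by rw [hF2.real 3 (by decide), hF1.real 3 (by decide)]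
    refine (emit_ends (D := D) hI hs2 rfl e8 (by rw [e7]) ?_ ?_ hi hen.mem hen.inj h2.2
      hen.exists_eq).mono (by gcongr) fun s3 hF3 h3 => ⟨h3.1, h3.2.1, ?_⟩
    · simpa only [HasSlots, e15, e16, e17, e18, e19, e20, r3] using hslots
    · simpa only [HasSums, e15, e17, r3] using hsums
    · have := h3.2.2
      rw [e15] at this
      omega
  · have : 1 ≤ K + 1 := by omega
    nlinarith

/-! ### Traversal of all machines through their edges -/

/-- Construction of the slots of all machines. -/
def buildSlots : Program :=
  .seq (.setNat 7 (.const 0) (.const 0))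
    (.loop (.natLE (.add (.var 7) (.const 1)) (.get 0 (.const 2)))
      (.seq (.branch (.natLE (.get 4 curMachine) (.add (.var 7) (.const 1))) processMachine .skip)
        (.setNat 7 (.const 0) (.add (.var 7) (.const 1)))))

/-- The number of the edges at machines that are treated later than the edge `e`. -/
def openEdges (N : ℕ) (mc : ℕ → ℕ) (e : ℕ) : ℕ :=
  ((Finset.range N).filter fun f => e < lastEdge N mc (mc f)).card

theorem openEdges_le (N : ℕ) (mc : ℕ → ℕ) (e : ℕ) : openEdges N mc e ≤ N := by
  simpa [openEdges] using Finset.card_filter_le (Finset.range N) fun f => e < lastEdge N mc (mc f)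

theorem openEdges_succ_le (N : ℕ) (mc : ℕ → ℕ) (e : ℕ) :
    openEdges N mc (e + 1) ≤ openEdges N mc e :=
  Finset.card_le_card fun f hf => by
    simp only [Finset.mem_filter] at hf ⊢; exact ⟨hf.1, by omega⟩

/-- At the last edge of a machine all edges of this machine are closed at once; the released
potential pays for its treatment. -/
theorem openEdges_succ_add {N : ℕ} {mc : ℕ → ℕ} {e : ℕ} (h : lastEdge N mc (mc e) = e + 1) :
    openEdges N mc (e + 1) + degree N mc (mc e) ≤ openEdges N mc e := by
  unfold openEdges degree
  rw [← Finset.card_union_of_disjoint]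
  · refine Finset.card_le_card fun f hf => ?_
    simp only [Finset.mem_union, Finset.mem_filter] at hf ⊢
    rcases hf with hf | hf
    · exact ⟨hf.1, by omega⟩
    · exact ⟨hf.1, by rw [hf.2]; omega⟩
  · rw [Finset.disjoint_left]
    intro f hf hf'
    simp only [Finset.mem_filter] at hf hf'
    rw [hf'.2] at hf
    omega

/-- The loop runs over the edges, because the number of machines is not bounded in terms of `|E|`. A
machine is treated at its last edge. As `lastEdge` of the current machine is always at least `e +
1`, the inequality tested by the program detects equality. -/
theorem buildSlots_ends {n N : ℕ} {job mc : ℕ → ℕ} {p x : ℕ → ℝ} {ε : ℝ} {K : ℕ} {s : Memory}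
    (hI : EdgeList n N job mc p x ε)
    (hs : HoldsInstance n N job mc p x ε s) (hL : HasLists N mc s) (hK : n < 2 ^ K)
    (h15 : s.nat 15 0 = 0) (h16 : s.nat 16 0 = 0) :
    Ends buildSlots s (5000 * (K + 1) * (N + 1)) fun s' =>
      HasSlots N mc p x (fun _ => True) s' ∧ HasSums N mc x ε (fun _ => True) s' ∧
      s'.nat 15 0 ≤ 6 * N := by
  refine (Ends.run_seq (B := 3) (B' := (4000 * (K + 1) * N + 60 * N) + 7)
    (by simp [Program.LoopFree]) (by decide) ?_).mono ?_ fun _ _ h => h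
  swap
  · nlinarith [Nat.zero_le (K * N), Nat.zero_le K, Nat.zero_le N]
  set s0 := Program.run _ s with hs0
  have hF0 : Frame (.setNat 7 (.const 0) (.const 0)) s s0 := by
    obtain ⟨t, -, ht⟩ := Program.LoopFree.runs (P := .setNat 7 (.const 0) (.const 0)) trivial s
    exact ht.frame
  have h7 : s0.nat 7 0 = 0 := by simp [hs0, Program.run, Memory.writeNat_nat, NatExpr.eval]
  clear_value s0
  have hs1 := hs.frame hF0 (by decide) (by decide)
  have hL1 : HasLists N mc s0 := ⟨fun k => by rw [hF0.nat 4 (by decide)]; exact hL.head k,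
    fun q => by rw [hF0.nat 5 (by decide)]; exact hL.next q⟩
  rw [← hF0.nat 15 (by decide)] at h15
  rw [← hF0.nat 16 (by decide)] at h16
  have hmem : ∀ f < N, f + 1 ≤ lastEdge N mc (mc f) := fun f hf =>
    Nat.le_findGreatest (P := fun q => mc (q - 1) = mc f) hf (by simp)
  -- The finished machines are those with `lastEdge` at most the counter; machines without edges
  -- have the value 0 and are finished from the start.
  refine (Ends.loop (I := fun t => t.nat 7 0 ≤ N ∧
      HasSlots N mc p x (fun k => lastEdge N mc k ≤ t.nat 7 0) t ∧
      HasSums N mc x ε (fun k => lastEdge N mc k ≤ t.nat 7 0) t ∧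
      t.nat 15 0 + 6 * openEdges N mc (t.nat 7 0) ≤ 6 * N)
    (φ := fun t => 4000 * (K + 1) * openEdges N mc (t.nat 7 0) + 60 * (N - t.nat 7 0))
      ?_ ?_).mono ?_ ?_
  · rw [h7]
    refine ⟨Nat.zero_le _, ?_, ?_, ?_⟩
    · rw [HasSlots, h15, h16]
      refine ⟨?_, ?_, ?_, ?_, ?_, ?_, ?_, fun t => by simp [fiberSum], ?_⟩ <;>
        (intros; omega)
    · intro e he _ hc
      have := hmem e he; omega
    · rw [h15]
      have := openEdges_le N mc 0
      omega
  · rintro t hF ⟨a1, a2, a3, a4⟩ hb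
    have hst := hs1.frame hF (by decide) (by decide)
    have hLt : HasLists N mc t := ⟨fun k => by rw [hF.nat 4 (by decide)]; exact hL1.head k,
      fun q => by rw [hF.nat 5 (by decide)]; exact hL1.next q⟩
    simp only [Test.Holds, NatExpr.eval, hst.edges] at hb
    set e := t.nat 7 0 with he
    have hfin : ∀ t' : Memory, t'.nat 7 0 = e →
        HasSlots N mc p x (fun k => lastEdge N mc k ≤ e + 1) t' →
        HasSums N mc x ε (fun k => lastEdge N mc k ≤ e + 1) t' →
        t'.nat 15 0 + 6 * openEdges N mc (e + 1) ≤ 6 * N →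
        Ends (.setNat 7 (.const 0) (.add (.var 7) (.const 1))) t' 10 fun t'' =>
          t''.nat 7 0 = e + 1 ∧
          HasSlots N mc p x (fun k => lastEdge N mc k ≤ e + 1) t'' ∧
          HasSums N mc x ε (fun k => lastEdge N mc k ≤ e + 1) t'' ∧
          t''.nat 15 0 + 6 * openEdges N mc (e + 1) ≤ 6 * N := by
      intro t' h1 h2 h3 h4
      refine .of_loopFree trivial (by decide) ?_
      simpa [Program.run, NatExpr.eval, Memory.writeNat_nat, Memory.writeNat_real, h1] using
        ⟨h2, h3, h4⟩
    by_cases hlast : lastEdge N mc (mc e) = e + 1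
    · have hD : (fun k => lastEdge N mc k ≤ e + 1) = fun k => lastEdge N mc k ≤ e ∨ k = mc e := by
        funext k
        refine propext ⟨fun h => ?_, ?_⟩
        · by_cases hk : lastEdge N mc k = e + 1
          · refine .inr ?_
            have := Nat.findGreatest_of_ne_zero (P := fun q => mc (q - 1) = k) hk (by omega)
            simpa using this.symm
          · exact .inl (by omega)
        · rintro (h | rfl)
          · omega
          · omega
      have hopen := openEdges_succ_add hlast
      refine ⟨_, Ends.seq (R := fun t' => t'.nat 7 0 = e ∧
        HasSlots N mc p x (fun k => lastEdge N mc k ≤ e + 1) t' ∧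
        HasSums N mc x ε (fun k => lastEdge N mc k ≤ e + 1) t' ∧
        t'.nat 15 0 + 6 * openEdges N mc (e + 1) ≤ 6 * N)
        (.branch (B := 4000 * (K + 1) * degree N mc (mc e)) (fun _ => ?_) (fun hc => ?_))
        fun t' _ ⟨b1, b2, b3, b4⟩ => (hfin t' b1 b2 b3 b4).mono le_rfl
          fun t'' _ ⟨c1, c2, c3, c4⟩ => ?_⟩
      · refine (processMachine_ends hI hst hLt he.symm hb hlast hK a2 a3 (by omega)).mono le_rfl ?_
        rintro t' hF' ⟨b1, b2, b3⟩
        refine ⟨by rw [hF'.nat 7 (by decide)], ?_, ?_, by omega⟩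
        · rw [hD]; exact b1
        · rw [hD]; exact b2
      · simp only [Test.Holds, NatExpr.eval, hLt.head, hst.mc, ← he] at hc
        omega
      · rw [c1]
        refine ⟨⟨hb, c2, c3, c4⟩, ?_⟩
        simp only [Test.cost, NatExpr.cost]
        have : 4000 * (K + 1) * openEdges N mc (e + 1) + 4000 * (K + 1) * degree N mc (mc e) ≤
            4000 * (K + 1) * openEdges N mc e := by
          rw [← mul_add]; exact Nat.mul_le_mul_left _ hopen
        omega
    · have hD : (fun k => lastEdge N mc k ≤ e + 1) = fun k => lastEdge N mc k ≤ e := by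
        funext k
        refine propext ⟨fun h => ?_, fun h => by omega⟩
        by_contra hk
        have hk : lastEdge N mc k = e + 1 := by omega
        have := Nat.findGreatest_of_ne_zero (P := fun q => mc (q - 1) = k) hk (by omega)
        simp only [Nat.add_sub_cancel] at this
        rw [this] at hlast
        exact hlast hk
      have hopen := openEdges_succ_le N mc e
      refine ⟨_, Ends.seq (R := fun t' => t'.nat 7 0 = e ∧
        HasSlots N mc p x (fun k => lastEdge N mc k ≤ e + 1) t' ∧
        HasSums N mc x ε (fun k => lastEdge N mc k ≤ e + 1) t' ∧
        t'.nat 15 0 + 6 * openEdges N mc (e + 1) ≤ 6 * N)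
        (.branch (B := 1) (fun hc => ?_) (fun _ => .of_loopFree trivial le_rfl ?_))
        fun t' _ ⟨b1, b2, b3, b4⟩ => (hfin t' b1 b2 b3 b4).mono le_rfl
          fun t'' _ ⟨c1, c2, c3, c4⟩ => ?_⟩
      · simp only [Test.Holds, NatExpr.eval, hLt.head, hst.mc, ← he] at hc
        have := hmem e hb
        omega
      · rw [hD]
        exact ⟨rfl, a2, a3, by simp only [Program.run]; omega⟩
      · rw [c1]
        refine ⟨⟨hb, c2, c3, c4⟩, ?_⟩
        simp only [Test.cost, NatExpr.cost]
        have : 4000 * (K + 1) * openEdges N mc (e + 1) ≤ 4000 * (K + 1) * openEdges N mc e :=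
          Nat.mul_le_mul_left _ hopen
        omega
  · have : 4000 * (K + 1) * openEdges N mc (s0.nat 7 0) ≤ 4000 * (K + 1) * N :=
      Nat.mul_le_mul_left _ (openEdges_le _ _ _)
    simp only [Test.cost, NatExpr.cost]
    omega
  · rintro t hF ⟨⟨a1, a2, a3, a4⟩, hb⟩
    have hst := hs1.frame hF (by decide) (by decide)
    simp only [Test.Holds, NatExpr.eval, hst.edges] at hb
    have hle : ∀ k, lastEdge N mc k ≤ t.nat 7 0 := fun k =>
      (Nat.findGreatest_le N).trans (by omega)
    simp only [hle] at a2 a3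
    exact ⟨a2, a3, by omega⟩

/-! ### Assignment of jobs to slots by labels and levels -/

/-- The invariant of the assignment of jobs to slots. The pair `q` (for `1 ≤ q ≤ Q`) joins the job
`jq q` and the slot `ps q`. The job `cur` looks for a slot, the jobs after `J` are not yet
treated. A job takes a slot whose level is smaller than its label, and raises the level to
the label; `ptr j` is the next pair that the job `j` considers. -/
structure Matching (n Q : ℕ) (jq ps mach out label ptr level occ aq : ℕ → ℕ) (J cur : ℕ) :
    Prop where
  cur_le : cur ≤ J
  le_jobs : J ≤ n
  cur_eq : J = n → cur = n
  occ_spec : ∀ t j, occ t = j + 1 → (j < n ∧ j ≤ J ∧ j ≠ cur) ∧ (1 ≤ aq j ∧ aq j ≤ Q) ∧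
    jq (aq j) = j ∧ ps (aq j) = t ∧ label j = level t ∧ out j = mach t
  free : ∀ t, occ t = 0 → level t = 0
  assigned : ∀ j ≤ J, j ≠ cur → occ (ps (aq j)) = j + 1
  near : ∀ q, 1 ≤ q → q ≤ Q → label (jq q) ≤ level (ps q) + 1
  scanned : ∀ q, 1 ≤ q → q ≤ Q → ptr (jq q) < q → label (jq q) ≤ level (ps q)
  ptr_le : ∀ j, ptr j ≤ Q
  ptr_eq : ∀ j, ptr j ≠ 0 → jq (ptr j) = j

section

variable {n Q : ℕ} {jq ps mach out label ptr level occ aq : ℕ → ℕ} {J cur : ℕ}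

/-- At pointer 0 all pairs of the job are scanned, so all its slots have level at least its label,
and `near` survives an increase by 1. Only a job without a slot is relabelled, so the labels of
occupants still equal the levels. -/
theorem Matching.relabel (h : Matching n Q jq ps mach out label ptr level occ aq J cur)
    (hptr : ptr cur = 0) :
    Matching n Q jq ps mach out (Function.update label cur (label cur + 1))
      (Function.update ptr cur (Nat.findGreatest (fun q => jq q = cur) Q)) level occ aq J cur := by
  obtain ⟨h1, h2, h3, h4, h5, h6, h7, h8, h9, h10⟩ := h
  refine ⟨h1, h2, h3, fun t j hj => ?_, h5, h6, fun q hq1 hq2 => ?_, fun q hq1 hq2 hq => ?_,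
    fun j => ?_, fun j hj => ?_⟩
  · have := h4 t j hj
    rw [Function.update_of_ne this.1.2.2]
    exact this
  · by_cases hc : jq q = cur
    · rw [hc, Function.update_self, ← hc]
      have := h8 q hq1 hq2 (by rw [hc, hptr]; exact hq1)
      omega
    · rw [Function.update_of_ne hc]; exact h7 q hq1 hq2
  · by_cases hc : jq q = cur
    · rw [hc, Function.update_self] at hq
      exact absurd hc (Nat.findGreatest_is_greatest (P := fun q => jq q = cur) hq hq2)
    · rw [Function.update_of_ne hc] at hq ⊢; exact h8 q hq1 hq2 hq
  · by_cases hc : j = cur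
    · rw [hc, Function.update_self]; exact Nat.findGreatest_le Q
    · rw [Function.update_of_ne hc]; exact h9 j
  · by_cases hc : j = cur
    · subst hc
      rw [Function.update_self] at hj ⊢
      exact Nat.findGreatest_of_ne_zero (P := fun q => jq q = j) rfl hj
    · rw [Function.update_of_ne hc] at hj ⊢; exact h10 j hj

/-- The pointer moves on, where the level of the slot may be raised. -/
theorem Matching.advance_aux (h : Matching n Q jq ps mach out label ptr level occ aq J cur)
    (hptr : ptr cur ≠ 0) {level' : ℕ → ℕ} (hlevel : ∀ t, level t ≤ level' t)
    (hle : label cur ≤ level' (ps (ptr cur))) {ptr' : ℕ → ℕ}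
    (hptr' : ptr' = Function.update ptr cur
      (Nat.findGreatest (fun q => jq q = cur) (ptr cur - 1))) :
    (∀ q, 1 ≤ q → q ≤ Q → label (jq q) ≤ level' (ps q) + 1) ∧
    (∀ q, 1 ≤ q → q ≤ Q → ptr' (jq q) < q → label (jq q) ≤ level' (ps q)) ∧
    (∀ j, ptr' j ≤ Q) ∧ (∀ j, ptr' j ≠ 0 → jq (ptr' j) = j) := by
  obtain ⟨h1, h2, h3, h4, h5, h6, h7, h8, h9, h10⟩ := h
  subst hptr'
  refine ⟨fun q hq1 hq2 => ?_, fun q hq1 hq2 hq => ?_, fun j => ?_, fun j hj => ?_⟩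
  · have := h7 q hq1 hq2
    have := hlevel (ps q)
    omega
  · have hl := hlevel (ps q)
    by_cases hc : jq q = cur
    · rw [hc, Function.update_self] at hq
      rcases lt_trichotomy q (ptr cur) with hlt | heq | hgt
      · exact absurd hc (Nat.findGreatest_is_greatest (P := fun q => jq q = cur) hq (by omega))
      · rw [hc, heq]; exact hle
      · exact (h8 q hq1 hq2 (by rw [hc]; exact hgt)).trans hl
    · rw [Function.update_of_ne hc] at hq
      exact (h8 q hq1 hq2 hq).trans hl
  · by_cases hc : j = cur
    · rw [hc, Function.update_self]
      exact (Nat.findGreatest_le _).trans ((Nat.sub_le _ _).trans (h9 cur))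
    · rw [Function.update_of_ne hc]; exact h9 j
  · by_cases hc : j = cur
    · subst hc
      rw [Function.update_self] at hj ⊢
      exact Nat.findGreatest_of_ne_zero (P := fun q => jq q = j) rfl hj
    · rw [Function.update_of_ne hc] at hj ⊢; exact h10 j hj

theorem Matching.advance (h : Matching n Q jq ps mach out label ptr level occ aq J cur)
    (hptr : ptr cur ≠ 0) (hle : label cur ≤ level (ps (ptr cur))) :
    Matching n Q jq ps mach out label
      (Function.update ptr cur (Nat.findGreatest (fun q => jq q = cur) (ptr cur - 1)))
      level occ aq J cur := by
  obtain ⟨a1, a2, a3, a4⟩ := h.advance_aux hptr (fun _ => le_rfl) hle rfl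
  exact ⟨h.cur_le, h.le_jobs, h.cur_eq, h.occ_spec, h.free, h.assigned, a1, a2, a3, a4⟩

/-- Levels only rise, so everything scanned earlier stays valid. An evicted job therefore keeps its
label and pointer and resumes its scan where it stopped. If the slot was free, the next untreated
job becomes current. -/
theorem Matching.grab (h : Matching n Q jq ps mach out label ptr level occ aq J cur)
    (hJ : J < n) (hptr : ptr cur ≠ 0) (hlt : level (ps (ptr cur)) < label cur)
    {J' cur' : ℕ}
    (hcur : (occ (ps (ptr cur)) = 0 ∧ J' = J + 1 ∧ cur' = J + 1) ∨
      (occ (ps (ptr cur)) = cur' + 1 ∧ J' = J)) :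
    Matching n Q jq ps mach (Function.update out cur (mach (ps (ptr cur)))) label
      (Function.update ptr cur (Nat.findGreatest (fun q => jq q = cur) (ptr cur - 1)))
      (Function.update level (ps (ptr cur)) (label cur))
      (Function.update occ (ps (ptr cur)) (cur + 1))
      (Function.update aq cur (ptr cur)) J' cur' := by
  obtain ⟨a1, a2, a3, a4⟩ := h.advance_aux hptr
    (level' := Function.update level (ps (ptr cur)) (label cur)) (fun t => by
      rw [Function.update_apply]; split_ifs with ht
      · rw [ht]; exact hlt.le
      · exact le_rfl) (by simp) rfl
  have hJ' : J ≤ J' ∧ J' ≤ n := by omega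
  have hne : cur ≠ cur' := by
    rcases hcur with ⟨b1, b2, b3⟩ | ⟨b1, b2⟩
    · have := h.cur_le; omega
    · exact (h.occ_spec _ _ b1).1.2.2.symm
  refine ⟨?_, hJ'.2, ?_, fun t j hj => ?_, fun t ht => ?_, fun j hj hjc => ?_, a1, a2, a3, a4⟩
  · rcases hcur with ⟨b1, b2, b3⟩ | ⟨b1, b2⟩
    · omega
    · have := (h.occ_spec _ _ b1).1.2.1; omega
  · intro hJn
    rcases hcur with ⟨b1, b2, b3⟩ | ⟨b1, b2⟩ <;> omega
  · by_cases ht : t = ps (ptr cur)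
    · rw [ht, Function.update_self] at hj
      obtain rfl : cur = j := by omega
      have := h.cur_le
      refine ⟨⟨by omega, by omega, hne⟩, ?_⟩
      rw [ht, Function.update_self, Function.update_self, Function.update_self]
      exact ⟨⟨by omega, h.ptr_le _⟩, h.ptr_eq _ hptr, rfl, rfl, rfl⟩
    · rw [Function.update_of_ne ht] at hj
      have hs := h.occ_spec t j hj
      refine ⟨⟨hs.1.1, by omega, ?_⟩, ?_⟩
      · rcases hcur with ⟨b1, b2, b3⟩ | ⟨b1, b2⟩
        · omega
        -- The evicted job held no second slot, since its slot is determined by `aq`.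
        · rintro rfl
          exact ht (hs.2.2.2.1.symm.trans (h.occ_spec _ _ b1).2.2.2.1)
      · rw [Function.update_of_ne hs.1.2.2, Function.update_of_ne hs.1.2.2,
          Function.update_of_ne ht]
        exact hs.2
  · by_cases hts : t = ps (ptr cur)
    · rw [hts, Function.update_self] at ht; omega
    · rw [Function.update_of_ne hts] at ht ⊢; exact h.free t ht
  · by_cases hjcur : j = cur
    · rw [hjcur, Function.update_self, Function.update_self]
    · rw [Function.update_of_ne hjcur]
      have hjJ : j ≤ J := by omega
      have ha := h.assigned j hjJ hjcur
      by_cases hts : ps (aq j) = ps (ptr cur)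
      · rw [hts] at ha; omega
      · rw [Function.update_of_ne hts]; exact ha

/-- The jobs whose label is at least `i`. -/
def highJobs (n : ℕ) (label : ℕ → ℕ) (i : ℕ) : Finset ℕ := (Finset.range n).filter (i ≤ label ·)

/-- The jobs in `S` carry the weight `1 + ε` each, and the slots that they meet carry at most 1
each. By `near` these slots have level at least `i ≥ 1`, so they are not free, and their occupants
are different jobs of label at least `i`. -/
theorem Matching.expansion (h : Matching n Q jq ps mach out label ptr level occ aq J cur)
    {y : ℕ → ℝ} {ε : ℝ} (hy : ∀ q, 1 ≤ q → q ≤ Q → 0 ≤ y q)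
    (hsum : ∀ j < n, fiberSum Q jq y j = 1 + ε) (hcap : ∀ t, fiberSum Q ps y t ≤ 1) {i : ℕ}
    (hi : 1 ≤ i) :
    (1 + ε) * (highJobs n label (i + 1)).card ≤ (highJobs n label i).card := by
  set S := highJobs n label (i + 1) with hS
  set T := ((Finset.Icc 1 Q).filter fun q => jq q ∈ S).image ps with hT
  have h1 : (1 + ε) * (S.card : ℝ) = ∑ q ∈ Finset.Icc 1 Q, if jq q ∈ S then y q else 0 := by
    have : ∑ j ∈ S, fiberSum Q jq y j = (1 + ε) * (S.card : ℝ) := by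
      rw [Finset.sum_congr rfl fun j (hj : j ∈ S) =>
        hsum j (Finset.mem_range.1 (Finset.mem_filter.1 hj).1), Finset.sum_const, nsmul_eq_mul]
      ring
    rw [← this]
    unfold fiberSum
    rw [Finset.sum_comm]
    exact Finset.sum_congr rfl fun q _ => by simp
  have h2 : ∑ q ∈ Finset.Icc 1 Q, (if jq q ∈ S then y q else 0) ≤
      ∑ t ∈ T, fiberSum Q ps y t := by
    unfold fiberSum
    rw [Finset.sum_comm]
    refine Finset.sum_le_sum fun q hq => ?_
    have hq' := Finset.mem_Icc.1 hq
    rw [Finset.sum_ite_eq]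
    by_cases hqS : jq q ∈ S
    · rw [if_pos hqS, if_pos (Finset.mem_image_of_mem _ (Finset.mem_filter.2 ⟨hq, hqS⟩))]
    · rw [if_neg hqS]
      split_ifs
      · exact hy q hq'.1 hq'.2
      · exact le_rfl
  have h3 : ∑ t ∈ T, fiberSum Q ps y t ≤ (T.card : ℝ) := by
    refine (Finset.sum_le_sum fun t _ => hcap t).trans ?_
    simp
  have h4 : T.card ≤ (highJobs n label i).card := by
    have key : ∀ t ∈ T, ∃ j, occ t = j + 1 ∧ i ≤ level t := by
      intro t ht
      obtain ⟨q, hq, rfl⟩ := Finset.mem_image.1 ht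
      obtain ⟨hq, hqS⟩ := Finset.mem_filter.1 hq
      have hq := Finset.mem_Icc.1 hq
      have := h.near q hq.1 hq.2
      have hl : i + 1 ≤ label (jq q) := (Finset.mem_filter.1 hqS).2
      have h0 : occ (ps q) ≠ 0 := fun h0 => by have := h.free _ h0; omega
      exact ⟨occ (ps q) - 1, by omega, by omega⟩
    refine Finset.card_le_card_of_injOn (fun t => occ t - 1) (fun t ht => ?_) ?_
    · obtain ⟨j, hj, hl⟩ := key t (Finset.mem_coe.1 ht)
      obtain ⟨b1, -, -, -, b2, -⟩ := h.occ_spec t j hj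
      refine Finset.mem_coe.2 (Finset.mem_filter.2 ?_)
      simp only [hj, Nat.add_sub_cancel, Finset.mem_range]
      exact ⟨b1.1, by omega⟩
    · intro t ht t' ht' htt
      obtain ⟨j, hj, -⟩ := key t (Finset.mem_coe.1 ht)
      obtain ⟨j', hj', -⟩ := key t' (Finset.mem_coe.1 ht')
      simp only [hj, hj', Nat.add_sub_cancel] at htt
      rw [← (h.occ_spec t j hj).2.2.2.1, ← (h.occ_spec t' j' hj').2.2.2.1, htt]
  rw [h1]
  exact h2.trans (h3.trans (by exact_mod_cast h4))

/-- Iterated expansion gives at least `(1 + ε) ^ L` jobs of label at least 1 as soon as one job has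
a label above `L`; there are only `n` jobs. -/
theorem Matching.label_le (h : Matching n Q jq ps mach out label ptr level occ aq J cur)
    {y : ℕ → ℝ} {ε : ℝ} (hε : 0 < ε) (hy : ∀ q, 1 ≤ q → q ≤ Q → 0 ≤ y q)
    (hsum : ∀ j < n, fiberSum Q jq y j = 1 + ε) (hcap : ∀ t, fiberSum Q ps y t ≤ 1) {L : ℕ}
    (hL : (n : ℝ) < (1 + ε) ^ L) {j : ℕ} (hj : j < n) : label j ≤ L := by
  by_contra hc
  have key : ∀ k, (1 + ε) ^ k * ((highJobs n label (k + 1)).card : ℝ) ≤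
      ((highJobs n label 1).card : ℝ) := by
    intro k
    induction k with
    | zero => simp
    | succ k ih =>
      refine le_trans ?_ ih
      rw [pow_succ, mul_assoc]
      exact mul_le_mul_of_nonneg_left (h.expansion hy hsum hcap (by omega)) (by positivity)
  have h1 : (1 : ℝ) ≤ ((highJobs n label (L + 1)).card : ℝ) := by
    exact_mod_cast Finset.card_pos.2 ⟨j, Finset.mem_filter.2 ⟨Finset.mem_range.2 hj, by omega⟩⟩
  have h2 : ((highJobs n label 1).card : ℝ) ≤ n := by
    have := Finset.card_filter_le (Finset.range n) (1 ≤ label ·)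
    rw [Finset.card_range] at this
    exact_mod_cast this
  have h3 : (1 + ε) ^ L * 1 ≤ (1 + ε) ^ L * ((highJobs n label (L + 1)).card : ℝ) :=
    mul_le_mul_of_nonneg_left h1 (by positivity)
  linarith [key L]

/-- The number of the pairs `1, …, k` of the job `j`. -/
def pairCount (jq : ℕ → ℕ) (j k : ℕ) : ℕ := ((Finset.Icc 1 k).filter fun q => jq q = j).card

/-- An upper bound for the number of the remaining steps of the assignment. -/
def matchPotential (n Q L : ℕ) (jq label ptr : ℕ → ℕ) : ℕ :=
  ∑ j ∈ Finset.range n, ((L + 1 - label j) * (pairCount jq j Q + 1) + pairCount jq j (ptr j))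

/-- Raising the label releases the cost of a full scan of the job plus one unit, and resetting the
pointer costs at most the scan. -/
theorem matchPotential_relabel {L : ℕ} (hc : cur < n) (hL : label cur ≤ L) {v : ℕ} (hv : v ≤ Q) :
    matchPotential n Q L jq (Function.update label cur (label cur + 1))
      (Function.update ptr cur v) + 1 ≤ matchPotential n Q L jq label ptr := by
  refine Nat.succ_le_of_lt (Finset.sum_lt_sum (fun j _ => ?_) ⟨cur, Finset.mem_range.2 hc, ?_⟩)
  · by_cases hj : j = cur
    · subst hj
      rw [Function.update_self, Function.update_self]
      have h1 : pairCount jq j v ≤ pairCount jq j Q :=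
        Finset.card_le_card (Finset.filter_subset_filter _ (Finset.Icc_subset_Icc_right hv))
      obtain ⟨b, hb⟩ : ∃ b, L + 1 - label j = b + 1 := ⟨L - label j, by omega⟩
      have hb' : L + 1 - (label j + 1) = b := by omega
      rw [hb, hb', add_mul]
      omega
    · rw [Function.update_of_ne hj, Function.update_of_ne hj]
  · rw [Function.update_self, Function.update_self]
    have h1 : pairCount jq cur v ≤ pairCount jq cur Q :=
      Finset.card_le_card (Finset.filter_subset_filter _ (Finset.Icc_subset_Icc_right hv))
    obtain ⟨b, hb⟩ : ∃ b, L + 1 - label cur = b + 1 := ⟨L - label cur, by omega⟩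
    have hb' : L + 1 - (label cur + 1) = b := by omega
    rw [hb, hb', add_mul]
    omega

theorem matchPotential_advance {L : ℕ} (hc : cur < n) (hptr : ptr cur ≠ 0)
    (hjq : jq (ptr cur) = cur) {v : ℕ} (hv : v ≤ ptr cur - 1) :
    matchPotential n Q L jq label (Function.update ptr cur v) + 1 ≤
      matchPotential n Q L jq label ptr := by
  have h1 : pairCount jq cur v < pairCount jq cur (ptr cur) := by
    refine Finset.card_lt_card (Finset.ssubset_iff_subset_ne.2
      ⟨Finset.filter_subset_filter _ (Finset.Icc_subset_Icc_right (by omega)), fun he => ?_⟩)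
    have : ptr cur ∈ (Finset.Icc 1 v).filter fun q => jq q = cur := by
      rw [he]
      exact Finset.mem_filter.2 ⟨Finset.mem_Icc.2 ⟨by omega, le_rfl⟩, hjq⟩
    have := (Finset.mem_Icc.1 (Finset.mem_filter.1 this).1).2
    omega
  refine Nat.succ_le_of_lt (Finset.sum_lt_sum (fun j _ => ?_) ⟨cur, Finset.mem_range.2 hc, ?_⟩)
  · by_cases hj : j = cur
    · subst hj
      rw [Function.update_self]
      omega
    · rw [Function.update_of_ne hj]
  · rw [Function.update_self]
    omega

theorem matchPotential_zero_le {L : ℕ} (hjq : ∀ q, 1 ≤ q → q ≤ Q → jq q < n)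
    (hl : ∀ j, label j = 0) (hp : ∀ j, ptr j = 0) :
    matchPotential n Q L jq label ptr ≤ (L + 1) * (Q + n) := by
  have h1 : ∑ j ∈ Finset.range n, pairCount jq j Q = Q := by
    have := Finset.card_eq_sum_card_fiberwise (s := Finset.Icc 1 Q) (t := Finset.range n) (f := jq)
      (fun q hq => by
        have hq := Finset.mem_Icc.1 (Finset.mem_coe.1 hq)
        exact Finset.mem_coe.2 (Finset.mem_range.2 (hjq q hq.1 hq.2)))
    rw [Nat.card_Icc, Nat.add_sub_cancel] at this
    exact this.symm
  unfold matchPotential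
  simp only [hl, hp]
  have h2 : ∀ j, pairCount jq j 0 = 0 := fun j => by simp [pairCount]
  simp only [h2, add_zero, Nat.sub_zero]
  rw [← Finset.mul_sum, Finset.sum_add_distrib, h1]
  simp

end

/-! ### The program for the assignment -/

/-- The current job. -/
abbrev curJob : NatExpr := .var 25

/-- The label of the current job is raised, and the list of its pairs is considered again. -/
def raiseLabel : Program :=
  .seq (.setNat 26 curJob (.add (.get 26 curJob) (.const 1))) (.setNat 27 curJob (.get 21 curJob))

/-- The next pair of the current job is considered. -/
def nextPair : Program :=
  .seq (.setNat 31 (.const 0) (.get 27 curJob)) (.setNat 27 curJob (.get 22 (.var 31)))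

/-- The current job takes the slot of the pair under consideration. -/
def grabSlot : Program :=
  .seq (.setNat 14 (.const 0) (.get 18 (.var 31)))
  (.seq (.setNat 28 (.var 14) (.get 26 curJob))
  (.seq (.setNat 30 curJob (.var 31))
  (.seq (.setNat 3 curJob (.get 19 (.var 14)))
  (.seq (.setNat 13 (.const 0) (.get 29 (.var 14)))
  (.seq (.setNat 29 (.var 14) (.add curJob (.const 1)))
  (.branch (.natLE (.var 13) (.const 0))
    (.seq (.setNat 24 (.const 0) (.add (.var 24) (.const 1))) (.setNat 25 (.const 0) (.var 24)))
    (.setNat 25 (.const 0) (.sub (.var 13) (.const 1)))))))))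

/-- A step of the assignment. -/
def matchBody : Program :=
  .branch (.natLE (.get 27 curJob) (.const 0)) raiseLabel
    (.seq nextPair (.branch (.natLE (.get 26 curJob) (.get 28 (.get 18 (.var 31)))) .skip grabSlot))

/-- The assignment of the jobs to slots. -/
def matchJobs : Program :=
  .loop (.natLE (.add (.var 24) (.const 1)) (.get 0 (.const 0))) matchBody

/-- The assignment that is held by the memory. -/
abbrev MatchingAt (n Q : ℕ) (jq ps mach : ℕ → ℕ) (s : Memory) : Prop :=
  Matching n Q jq ps mach (s.nat 3) (s.nat 26) (s.nat 27) (s.nat 28) (s.nat 29) (s.nat 30)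
    (s.nat 24 0) (s.nat 25 0)

theorem matchBody_run {n Q L : ℕ} {jq ps mach : ℕ → ℕ} {s : Memory}
    (h : MatchingAt n Q jq ps mach s) (h18 : s.nat 18 = ps) (h19 : s.nat 19 = mach)
    (h21 : ∀ k, s.nat 21 k = Nat.findGreatest (fun q => jq q = k) Q)
    (h22 : ∀ q, 1 ≤ q → q ≤ Q → s.nat 22 q = Nat.findGreatest (fun q' => jq q' = jq q) (q - 1))
    (hJ : s.nat 24 0 < n) (hlabel : ∀ j < n, s.nat 26 j ≤ L) :
    MatchingAt n Q jq ps mach (matchBody.run s) ∧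
      matchPotential n Q L jq ((matchBody.run s).nat 26) ((matchBody.run s).nat 27) + 1 ≤
        matchPotential n Q L jq (s.nat 26) (s.nat 27) := by
  have hcur : s.nat 25 0 < n := h.cur_le.trans_lt hJ
  by_cases hptr : s.nat 27 (s.nat 25 0) = 0
  · refine ⟨?_, ?_⟩
    · have := h.relabel hptr
      simpa [MatchingAt, matchBody, raiseLabel, Program.run, Test.Holds, NatExpr.eval, hptr,
        Memory.writeNat_nat, h21] using this
    · have := matchPotential_relabel (jq := jq) (ptr := s.nat 27) hcur (hlabel _ hcur)
        (Nat.findGreatest_le (P := fun q => jq q = s.nat 25 0) Q)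
      simpa [MatchingAt, matchBody, raiseLabel, Program.run, Test.Holds, NatExpr.eval, hptr,
        Memory.writeNat_nat, h21] using this
  · have hjq := h.ptr_eq _ hptr
    have hnext := h22 (s.nat 27 (s.nat 25 0)) (by omega) (h.ptr_le _)
    rw [hjq] at hnext
    have hpot := matchPotential_advance (L := L) (Q := Q) (label := s.nat 26) hcur hptr hjq
        (Nat.findGreatest_le (P := fun q => jq q = s.nat 25 0) _)
    by_cases hle : s.nat 26 (s.nat 25 0) ≤ s.nat 28 (ps (s.nat 27 (s.nat 25 0)))
    · refine ⟨?_, ?_⟩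
      · have := h.advance hptr hle
        simpa [MatchingAt, matchBody, nextPair, Program.run, Test.Holds, NatExpr.eval, hptr,
          Memory.writeNat_nat, h18, hnext, hle] using this
      · simpa [MatchingAt, matchBody, nextPair, Program.run, Test.Holds, NatExpr.eval, hptr,
          Memory.writeNat_nat, h18, hnext, hle] using hpot
    · by_cases hocc : s.nat 29 (ps (s.nat 27 (s.nat 25 0))) = 0
      · refine ⟨?_, ?_⟩
        · have := h.grab hJ hptr (not_le.1 hle) (.inl ⟨hocc, rfl, rfl⟩)
          simpa [MatchingAt, matchBody, nextPair, grabSlot, Program.run, Test.Holds, NatExpr.eval, hptr,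
            Memory.writeNat_nat, h18, h19, hnext, hle, hocc] using this
        · simpa [MatchingAt, matchBody, nextPair, grabSlot, Program.run, Test.Holds, NatExpr.eval, hptr,
            Memory.writeNat_nat, h18, h19, hnext, hle, hocc] using hpot
      · refine ⟨?_, ?_⟩
        · have := h.grab hJ hptr (not_le.1 hle)
            (cur' := s.nat 29 (ps (s.nat 27 (s.nat 25 0))) - 1) (.inr ⟨by omega, rfl⟩)
          simpa [MatchingAt, matchBody, nextPair, grabSlot, Program.run, Test.Holds, NatExpr.eval, hptr,
            Memory.writeNat_nat, h18, h19, hnext, hle, hocc] using this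
        · simpa [MatchingAt, matchBody, nextPair, grabSlot, Program.run, Test.Holds, NatExpr.eval, hptr,
            Memory.writeNat_nat, h18, h19, hnext, hle, hocc] using hpot

theorem matchJobs_ends {n Q L : ℕ} {jq ps mach : ℕ → ℕ} {y : ℕ → ℝ} {ε : ℝ} {s : Memory}
    (h0 : s.nat 0 0 = n) (h18 : s.nat 18 = ps) (h19 : s.nat 19 = mach)
    (h21 : ∀ k, s.nat 21 k = Nat.findGreatest (fun q => jq q = k) Q)
    (h22 : ∀ q, 1 ≤ q → q ≤ Q → s.nat 22 q = Nat.findGreatest (fun q' => jq q' = jq q) (q - 1))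
    (hz : ∀ a, 24 ≤ a → ∀ k, s.nat a k = 0) (hjq : ∀ q, 1 ≤ q → q ≤ Q → jq q < n)
    (hε : 0 < ε) (hy : ∀ q, 1 ≤ q → q ≤ Q → 0 ≤ y q)
    (hsum : ∀ j < n, fiberSum Q jq y j = 1 + ε) (hcap : ∀ t, fiberSum Q ps y t ≤ 1)
    (hL : (n : ℝ) < (1 + ε) ^ L) :
    Ends matchJobs s (150 * ((L + 1) * (Q + n) + 1)) fun s' => ∃ τ : ℕ → ℕ,
      (∀ j < n, 1 ≤ τ j ∧ τ j ≤ Q ∧ jq (τ j) = j ∧ s'.nat 3 j = mach (ps (τ j))) ∧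
      ∀ j < n, ∀ j' < n, ps (τ j) = ps (τ j') → j = j' := by
  refine (Ends.loop (I := MatchingAt n Q jq ps mach)
    (φ := fun t => 150 * matchPotential n Q L jq (t.nat 26) (t.nat 27)) ?_ ?_).mono ?_ ?_
  -- Zeroed memory is already a valid state: job 0 is current, all slots are free, and labels 0 make
  -- `near` and `scanned` trivial.
  · unfold MatchingAt
    rw [hz 24 (by norm_num), hz 25 (by norm_num)]
    exact ⟨le_rfl, Nat.zero_le _, fun h => h, fun t j h => by
        rw [hz 29 (by norm_num)] at h; omega,
      fun t _ => hz 28 (by norm_num) t, fun j hj hj' => by omega,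
      fun q _ _ => by rw [hz 26 (by norm_num)]; omega,
      fun q _ _ _ => by rw [hz 26 (by norm_num)]; omega,
      fun j => by rw [hz 27 (by norm_num)]; omega,
      fun j hj => absurd (hz 27 (by norm_num) j) hj⟩
  · intro t hF ht hb
    simp only [Test.Holds, NatExpr.eval, hF.nat 0 (by decide), h0] at hb
    refine ⟨130, .of_loopFree
      (by simp [matchBody, raiseLabel, nextPair, grabSlot, Program.LoopFree]) (by decide) ?_⟩
    obtain ⟨a1, a2⟩ := matchBody_run (L := L) ht ((hF.nat 18 (by decide)).trans h18)
      ((hF.nat 19 (by decide)).trans h19)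
      (fun k => by rw [hF.nat 21 (by decide)]; exact h21 k)
      (fun q h1 h2 => by rw [hF.nat 22 (by decide)]; exact h22 q h1 h2) (by omega)
      (fun j hj => ht.label_le hε hy hsum hcap hL hj)
    refine ⟨a1, ?_⟩
    simp only [Test.cost, NatExpr.cost]
    omega
  · have := matchPotential_zero_le (L := L) (label := s.nat 26) (ptr := s.nat 27) hjq
      (hz 26 (by norm_num)) (hz 27 (by norm_num))
    simp only [Test.cost, NatExpr.cost]
    omega
  · rintro t hF ⟨ht, hb⟩
    simp only [Test.Holds, NatExpr.eval, hF.nat 0 (by decide), h0] at hb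
    have hJ : t.nat 24 0 = n := le_antisymm ht.le_jobs (by omega)
    -- The current index is now `n` itself, so no job below `n` is exempt from `assigned`.
    have hc := ht.cur_eq hJ
    have key : ∀ j < n, t.nat 29 (ps (t.nat 30 j)) = j + 1 := fun j hj =>
      ht.assigned j (by omega) (by omega)
    refine ⟨t.nat 30, fun j hj => ?_, fun j hj j' hj' hjj => ?_⟩
    · obtain ⟨-, b2, b3, -, -, b4⟩ := ht.occ_spec _ j (key j hj)
      exact ⟨b2.1, b2.2, b3, b4⟩
    · have h1 := key j hj
      have h2 := key j' hj'
      rw [hjj] at h1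
      omega

/-! ### From different slots to the load bound -/

section

variable {n N Q T : ℕ} {job mc pe ps mach fs : ℕ → ℕ} {p x y : ℕ → ℝ} {ε : ℝ}

theorem sum_pairs_eq (hpe : ∀ q, 1 ≤ q → q ≤ Q → pe q < N) (A : ℕ → Prop) [DecidablePred A]
    (g : ℕ → ℝ) :
    ∑ q ∈ Finset.Icc 1 Q, (if A (pe q) then g (pe q) * y q else 0) =
      ∑ e ∈ (Finset.range N).filter A, g e * fiberSum Q pe y e := by
  unfold fiberSum
  simp only [Finset.mul_sum]
  rw [Finset.sum_comm]
  refine Finset.sum_congr rfl fun q hq => ?_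
  have hq := Finset.mem_Icc.1 hq
  simp only [mul_ite, mul_zero, Finset.sum_ite_eq, Finset.mem_filter, Finset.mem_range,
    hpe q hq.1 hq.2, true_and]

theorem EdgeList.fiberSum_edge (hI : EdgeList n N job mc p x ε)
    (h : SlotSystem N mc p x (fun _ => True) Q T pe ps y mach fs)
    (hsum : ∀ e < N, 0 < x e → True → fiberSum Q pe y e = (1 + ε) * x e) {e : ℕ} (he : e < N) :
    fiberSum Q pe y e = (1 + ε) * x e := by
  rcases (hI.x_nonneg e he).eq_or_lt with hx | hx
  · rw [← hx, mul_zero]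
    refine fiberSum_eq_zero fun q h1 h2 hq => ?_
    have := h.x_pos q h1 h2
    rw [hq, ← hx] at this
    exact lt_irrefl _ this
  · exact hsum e he hx trivial

theorem EdgeList.fiberSum_job (hI : EdgeList n N job mc p x ε)
    (h : SlotSystem N mc p x (fun _ => True) Q T pe ps y mach fs)
    (hsum : ∀ e < N, 0 < x e → True → fiberSum Q pe y e = (1 + ε) * x e) {j : ℕ} (hj : j < n) :
    fiberSum Q (fun q => job (pe q)) y j = 1 + ε := by
  have := sum_pairs_eq (y := y) h.edge_lt (fun e => job e = j) fun _ => 1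
  simp only [one_mul] at this
  unfold fiberSum
  rw [this, Finset.sum_congr rfl fun e he =>
    hI.fiberSum_edge h hsum (Finset.mem_range.1 (Finset.mem_filter.1 he).1), ← Finset.mul_sum,
    hI.sum_eq_one j hj, mul_one]

/-- If the jobs get pairwise different slots, then the load of a machine exceeds its fractional load
by at most the largest processing time. -/
theorem EdgeList.load_le (hI : EdgeList n N job mc p x ε)
    (h : SlotSystem N mc p x (fun _ => True) Q T pe ps y mach fs)
    (hsum : ∀ e < N, 0 < x e → True → fiberSum Q pe y e = (1 + ε) * x e) {τ : ℕ → ℕ}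
    (hτ : ∀ j < n, 1 ≤ τ j ∧ τ j ≤ Q)
    (hinj : ∀ j < n, ∀ j' < n, ps (τ j) = ps (τ j') → j = j') (i : ℕ) {M : ℝ} (hM0 : 0 ≤ M)
    (hM : ∀ j < n, mc (pe (τ j)) = i → p (pe (τ j)) ≤ M) :
    ∑ j ∈ (Finset.range n).filter (fun j => mc (pe (τ j)) = i), p (pe (τ j)) ≤
      M + (1 + ε) * ∑ e ∈ (Finset.range N).filter (fun e => mc e = i), p e * x e := by
  set A := (Finset.range n).filter fun j => mc (pe (τ j)) = i with hA
  have hmem : ∀ j ∈ A, j < n ∧ mc (pe (τ j)) = i := fun j hj => by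
    simpa [hA] using hj
  -- At most one job sits in the first slot of `i` and is charged to `M`; every other job is charged
  -- to the slot preceding its own.
  rw [← Finset.sum_filter_add_sum_filter_not A (fun j => ps (τ j) = fs i)]
  refine add_le_add ?_ ?_
  · have hcard : (A.filter fun j => ps (τ j) = fs i).card ≤ 1 := by
      rw [Finset.card_le_one]
      intro j hj j' hj'
      obtain ⟨h1, h2⟩ := Finset.mem_filter.1 hj
      obtain ⟨h3, h4⟩ := Finset.mem_filter.1 hj'
      exact hinj j (hmem j h1).1 j' (hmem j' h3).1 (h2.trans h4.symm)
    refine (Finset.sum_le_card_nsmul _ _ M fun j hj => ?_).trans ?_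
    · have := hmem j (Finset.mem_filter.1 hj).1
      exact hM j this.1 this.2
    · rw [nsmul_eq_mul]
      have : (((A.filter fun j => ps (τ j) = fs i).card : ℕ) : ℝ) ≤ 1 := by exact_mod_cast hcard
      nlinarith
  · set B := A.filter fun j => ¬ ps (τ j) = fs i with hB
    have hfull : ∀ j ∈ B, j < n ∧ 2 ≤ ps (τ j) ∧ mach (ps (τ j) - 1) = i ∧
        p (pe (τ j)) ≤ ∑ q ∈ Finset.Icc 1 Q,
          if ps q = ps (τ j) - 1 then p (pe q) * y q else 0 := by
      intro j hj
      obtain ⟨hjA, hjf⟩ := Finset.mem_filter.1 hj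
      obtain ⟨hjn, hji⟩ := hmem j hjA
      obtain ⟨t1, t2⟩ := hτ j hjn
      have hmach : mach (ps (τ j)) = i := (h.mach_eq _ t1 t2).trans hji
      obtain ⟨c1, c2, c3, c4⟩ := (h.full _ (h.slot_pos _ t1 t2) (h.slot_le _ t1 t2)).resolve_left
        (by rw [hmach]; exact hjf)
      refine ⟨hjn, c1, c2.trans hmach, ?_⟩
      calc p (pe (τ j)) = p (pe (τ j)) * fiberSum Q ps y (ps (τ j) - 1) := by rw [c3, mul_one]
        _ ≤ _ := by
          unfold fiberSum
          rw [Finset.mul_sum]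
          refine Finset.sum_le_sum fun q hq => ?_
          have hq := Finset.mem_Icc.1 hq
          split_ifs with hps
          · exact mul_le_mul_of_nonneg_right (c4 q _ hq.1 hq.2 t1 t2 hps rfl)
              (h.y_nonneg q hq.1 hq.2)
          · rw [mul_zero]
    refine (Finset.sum_le_sum fun j hj => (hfull j hj).2.2.2).trans ?_
    rw [Finset.sum_comm]
    -- Different jobs have different preceding slots, so each pair is charged at most once. The
    -- bound `2 ≤ ps (τ j)` makes the truncated subtraction harmless.
    have hq : ∀ q ∈ Finset.Icc 1 Q,
        (∑ j ∈ B, if ps q = ps (τ j) - 1 then p (pe q) * y q else 0) ≤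
          if mc (pe q) = i then p (pe q) * y q else 0 := by
      intro q hq
      have hq := Finset.mem_Icc.1 hq
      have hnn : 0 ≤ p (pe q) * y q :=
        mul_nonneg (hI.p_pos _ (h.edge_lt q hq.1 hq.2)).le (h.y_nonneg q hq.1 hq.2)
      by_cases hex : ∃ j ∈ B, ps q = ps (τ j) - 1
      · obtain ⟨j, hj, hjq⟩ := hex
        obtain ⟨d1, d2, d3, -⟩ := hfull j hj
        rw [Finset.sum_eq_single_of_mem j hj, if_pos hjq, if_pos]
        · rw [← h.mach_eq q hq.1 hq.2, hjq, d3]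
        · intro j' hj' hne
          obtain ⟨d1', d2', -, -⟩ := hfull j' hj'
          refine if_neg fun hc => hne (hinj j' d1' j d1 ?_)
          omega
      · push Not at hex
        rw [Finset.sum_eq_zero fun j hj => if_neg (hex j hj)]
        split_ifs
        · exact hnn
        · exact le_rfl
    refine (Finset.sum_le_sum hq).trans ?_
    rw [sum_pairs_eq h.edge_lt (fun e => mc e = i) p, Finset.mul_sum]
    refine le_of_eq (Finset.sum_congr rfl fun e he => ?_)
    rw [hI.fiberSum_edge h hsum (Finset.mem_range.1 (Finset.mem_filter.1 he).1)]
    ring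

/-- A job without edges would have an empty sum equal to 1. Terms in `n` are thus absorbed by the
number of edges. -/
theorem EdgeList.jobs_le (hI : EdgeList n N job mc p x ε) : n ≤ N := by
  have : ∀ j < n, ∃ e < N, job e = j := by
    intro j hj
    by_contra hc
    push Not at hc
    have := hI.sum_eq_one j hj
    rw [Finset.filter_false_of_mem fun e he => hc e (Finset.mem_range.1 he)] at this
    simp at this
  have hsub : Finset.range n ⊆ (Finset.range N).image job := fun j hj => by
    obtain ⟨e, he, rfl⟩ := this j (Finset.mem_range.1 hj)
    exact Finset.mem_image_of_mem _ (Finset.mem_range.2 he)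
  simpa using (Finset.card_le_card hsub).trans Finset.card_image_le

end

/-! ### The whole algorithm and its running time -/

/-- The rounding algorithm: the edges are listed by machines, every machine gets slots for its edges
in the order of decreasing processing times, and the jobs are assigned to slots.

Natural number arrays beyond the input: `3` output; `4`, `5` lists of the edges at the machines;
`6` edges of the current machine, `8` their number; `7` current edge or pair, `9` next edge to load;
`10`, `11` bounds of the heap, `12` position of the sinking entry, `13` its child, `14` temporary;
`15` number of pairs, `16` number of slots, `17`, `18` edge and slot of a pair, `19` machine of a slot,
`20` first slot of a machine; `21`, `22` lists of the pairs of the jobs; `23` position in the sorted list;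
`24` number of treated jobs, `25` current job, `26`, `27` labels and pointers of the jobs,
`28`, `29` levels and occupants of the slots, `30` chosen pairs of the jobs, `31` current pair.
Real number arrays beyond the input: `3` weights of the pairs, `4` weight left of the current edge,
`5` capacity left of the current slot, `6` weight of the new pair. -/
def roundingProgram : Program :=
  .seq (bucket 7 4 5 (.get 0 (.const 2)) (.get 2 (.sub (.var 7) (.const 1))))
    (.seq buildSlots
      (.seq (bucket 7 21 22 (.var 15) (.get 1 (.get 17 (.var 7)))) matchJobs))

theorem roundingProgram_ends {n N K L : ℕ} {job mc : ℕ → ℕ} {p x : ℕ → ℝ} {ε : ℝ} {s : Memory}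
    (hI : EdgeList n N job mc p x ε) (hs : HoldsInstance n N job mc p x ε s)
    (hz : ∀ a, 3 ≤ a → ∀ k, s.nat a k = 0) (hn : 0 < n) (hK : n < 2 ^ K)
    (hL : (n : ℝ) < (1 + ε) ^ L) :
    Ends roundingProgram s (N * (12000 * (K + 1) + 1200 * (L + 1))) fun s' => ∃ f : ℕ → ℕ,
      (∀ j < n, f j < N ∧ job (f j) = j ∧ 0 < x (f j) ∧ s'.nat 3 j = mc (f j)) ∧
      ∀ i M, 0 ≤ M → (∀ j < n, mc (f j) = i → p (f j) ≤ M) →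
        ∑ j ∈ (Finset.range n).filter (fun j => mc (f j) = i), p (f j) ≤
          M + (1 + ε) * ∑ e ∈ (Finset.range N).filter (fun e => mc e = i), p e * x e := by
  have hnN := hI.jobs_le
  refine (Ends.seq (B := 34 * (N + 1))
    (B' := 5000 * (K + 1) * (N + 1) + (40 * (6 * N + 1) + 150 * ((L + 1) * (6 * N + n) + 1)))
    ((bucket_ends (N := N) (K := fun q => mc (q - 1)) (by norm_num) (by norm_num) (by norm_num)
      (hz 4 (by norm_num)) (fun s' hF => ?_) fun s' hF => ?_).mono ?_ fun _ _ h => h)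
    fun s1 hF1 h1 => ?_).mono ?_ fun _ _ h => h
  · exact (hs.frame hF (by decide) (by decide)).edges
  · simp only [NatExpr.eval, (hs.frame hF (by decide) (by decide)).mc]
  · simp [NatExpr.cost]
  swap
  · have a1 : 1 ≤ N := by omega
    have a2 : (L + 1) * (6 * N + n) ≤ (L + 1) * (7 * N) := Nat.mul_le_mul_left _ (by omega)
    have a3 : 5000 * (K + 1) * (N + 1) ≤ 5000 * (K + 1) * (2 * N) :=
      Nat.mul_le_mul_left _ (by omega)
    nlinarith [Nat.zero_le (K * N), Nat.zero_le (L * N)]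
  have hs1 := hs.frame hF1 (by decide) (by decide)
  refine (buildSlots_ends hI hs1 ⟨h1.1, h1.2⟩ hK ?_ ?_).seq fun s2 hF2 ⟨b1, b2, b3⟩ => ?_
  · rw [hF1.nat 15 (by decide), hz 15 (by norm_num)]
  · rw [hF1.nat 16 (by decide), hz 16 (by norm_num)]
  have hs2 := hs1.frame hF2 (by decide) (by decide)
  -- Among the arrays from `21` on, only `23` is written before this point, so the pair lists and
  -- the assignment start from zeroed arrays.
  have hz2 : ∀ a, 21 ≤ a → a ≠ 23 → ∀ k, s2.nat a k = 0 := by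
    intro a ha ha' k
    rw [hF2.nat a ?_, hF1.nat a ?_, hz a (by omega)]
    · simp [bucket, bucketBody, Program.natWrites]; omega
    · simp [buildSlots, processMachine, loadMachine, loadBody, heapSort, heapStep, siftDown,
        siftBody, selectChild, emit, emitInit, openSlot, appendPair, Program.natWrites]
      omega
  set Q := s2.nat 15 0 with hQ
  set pe := s2.nat 17 with hpe
  refine (Ends.seq (B := 40 * (6 * N + 1)) (B' := 150 * ((L + 1) * (6 * N + n) + 1))
    ((bucket_ends (N := Q) (K := fun q => job (pe q)) (by norm_num) (by norm_num) (by norm_num)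
      (hz2 21 (by norm_num) (by norm_num)) (fun s' hF => ?_) fun s' hF => ?_).mono ?_
      fun _ _ h => h)
    fun s3 hF3 h3 => ?_).mono le_rfl fun _ _ h => h
  · simp only [NatExpr.eval, hF.nat 15 (by decide), hQ]
  · simp only [NatExpr.eval, (hs2.frame hF (by decide) (by decide)).job, hF.nat 17 (by decide), hpe]
  · simp only [NatExpr.cost]; omega
  have hs3 := hs2.frame hF3 (by decide) (by decide)
  refine (matchJobs_ends (y := s2.real 3) (L := L) hs3.jobs (hF3.nat 18 (by decide))
    (hF3.nat 19 (by decide)) h3.1 h3.2 (fun a ha k => ?_)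
    (fun q q1 q2 => hI.job_lt _ (b1.edge_lt q q1 q2)) hI.eps_pos b1.y_nonneg
    (fun j hj => hI.fiberSum_job b1 b2 hj) b1.cap hL).mono ?_ ?_
  · rw [hF3.nat a ?_, hz2 a (by omega) (by omega)]
    simp [bucket, bucketBody, Program.natWrites]; omega
  · gcongr
  · rintro s4 hF4 ⟨τ, c1, c2⟩
    refine ⟨fun j => pe (τ j), fun j hj => ?_, fun i M hM0 hM => ?_⟩
    · obtain ⟨d1, d2, d3, d4⟩ := c1 j hj
      exact ⟨b1.edge_lt _ d1 d2, d3, b1.x_pos _ d1 d2, d4.trans (b1.mach_eq _ d1 d2)⟩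
    · exact hI.load_le b1 b2 (fun j hj => ⟨(c1 j hj).1, (c1 j hj).2.1⟩) c2 i hM0 hM

/-- The number of the rounds of the algorithm is logarithmic. -/
theorem exists_exponents {n : ℕ} {ε : ℝ} (hn : 0 < n) (hε : 0 < ε) (hε1 : ε ≤ 1) :
    ∃ K L : ℕ, n < 2 ^ K ∧ (n : ℝ) < (1 + ε) ^ L ∧
      (12000 * ((K : ℝ) + 1) + 1200 * ((L : ℝ) + 1)) ≤ 100000 * (Real.log ((n : ℝ) + 1) / ε) := by
  set l := Real.log ((n : ℝ) + 1) with hl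
  have hn1 : (1 : ℝ) ≤ n := by exact_mod_cast hn
  have hlog2 := Real.log_two_gt_d9
  have hl2 : Real.log 2 ≤ l := Real.log_le_log (by norm_num) (by linarith)
  have hlpos : 0 < l := by linarith
  have hle : l ≤ l / ε := by rw [le_div_iff₀ hε]; nlinarith
  -- The power even exceeds `n + 1`. Working with `log (n + 1)` keeps the bound positive for `n =
  -- 1`, so that additive constants can be absorbed.
  have key : ∀ b : ℝ, 1 < b → (n : ℝ) < b ^ (⌊l / Real.log b⌋₊ + 1) := by
    intro b hb
    have hlb : 0 < Real.log b := Real.log_pos hb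
    have h1 : l / Real.log b < (⌊l / Real.log b⌋₊ + 1 : ℕ) := by
      exact_mod_cast Nat.lt_floor_add_one (l / Real.log b)
    rw [div_lt_iff₀ hlb, hl, ← Real.log_pow, Real.log_lt_log_iff (by linarith) (by positivity)] at h1
    linarith
  refine ⟨⌊l / Real.log 2⌋₊ + 1, ⌊l / Real.log (1 + ε)⌋₊ + 1, ?_, key _ (by linarith), ?_⟩
  · exact_mod_cast key 2 (by norm_num)
  · have h1 : ((⌊l / Real.log 2⌋₊ : ℕ) : ℝ) ≤ 2 * l := by
      refine (Nat.floor_le (by positivity)).trans ?_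
      rw [div_le_iff₀ (by linarith)]
      nlinarith
    have h2 : ((⌊l / Real.log (1 + ε)⌋₊ : ℕ) : ℝ) ≤ 2 * (l / ε) := by
      -- This is `log (1 + ε) ≥ 1 - 1 / (1 + ε) = ε / (1 + ε)`, combined with `ε ≤ 1`.
      have hlb : ε / 2 ≤ Real.log (1 + ε) := by
        have := Real.one_sub_inv_le_log_of_pos (show 0 < 1 + ε by linarith)
        refine le_trans ?_ this
        rw [le_sub_iff_add_le, ← le_sub_iff_add_le', inv_le_comm₀ (by linarith) (by linarith),
          inv_le_iff_one_le_mul₀ (by linarith)]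
        nlinarith
      refine (Nat.floor_le (div_nonneg hlpos.le (by linarith))).trans ?_
      calc l / Real.log (1 + ε) ≤ l / (ε / 2) :=
            div_le_div_of_nonneg_left hlpos.le (by linarith) hlb
        _ = 2 * (l / ε) := by field_simp
    push_cast
    linarith

/-! ### Translation between the input memory and the instance -/

section

variable {n m : ℕ} (E : Finset (Fin n × Fin m)) (edge : Fin E.card ≃ {e // e ∈ E})
  (p : Fin m → Fin n → ℝ) (x : Fin n → Fin m → ℝ) (ε : ℝ)

theorem input_job (k : Fin E.card) : (input E edge p x ε).nat 1 k = ((edge k).1.1 : ℕ) := by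
  simp [input]

theorem input_mc (k : Fin E.card) : (input E edge p x ε).nat 2 k = ((edge k).1.2 : ℕ) := by
  simp [input]

theorem input_time (k : Fin E.card) :
    (input E edge p x ε).real 1 k = p (edge k).1.2 (edge k).1.1 := by
  simp [input]

theorem input_frac (k : Fin E.card) :
    (input E edge p x ε).real 2 k = x (edge k).1.1 (edge k).1.2 := by
  simp [input]

theorem sum_edges (A : ℕ → Prop) [DecidablePred A] (f : ℕ → ℝ) (g : Fin n × Fin m → ℝ)
    (B : Fin n × Fin m → Prop) [DecidablePred B] (hA : ∀ k : Fin E.card, A k ↔ B (edge k).1)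
    (hf : ∀ k : Fin E.card, f k = g (edge k).1) :
    ∑ k ∈ (Finset.range E.card).filter A, f k = ∑ e ∈ E.filter B, g e := by
  rw [Finset.sum_filter, Finset.sum_range, Finset.sum_filter,
    ← Finset.sum_coe_sort E fun e => if B e then g e else 0,
    ← Equiv.sum_comp edge fun e : {e // e ∈ E} => if B e.1 then g e.1 else 0]
  exact Finset.sum_congr rfl fun k _ => by simp only [hA, hf]

theorem sum_edges_of_job (g : Fin n × Fin m → ℝ) (j : Fin n) :
    ∑ e ∈ E.filter (fun e => e.1 = j), g e =
      ∑ i ∈ Finset.univ.filter (fun i => (j, i) ∈ E), g (j, i) := by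
  refine Finset.sum_bij' (fun e _ => e.2) (fun i _ => (j, i)) ?_ ?_ ?_ ?_ ?_ <;>
    simp +contextual [Prod.forall]
  all_goals rintro a b h rfl; simp [h]

theorem sum_edges_of_machine (g : Fin n × Fin m → ℝ) (i : Fin m) :
    ∑ e ∈ E.filter (fun e => e.2 = i), g e =
      ∑ j ∈ Finset.univ.filter (fun j => (j, i) ∈ E), g (j, i) := by
  refine Finset.sum_bij' (fun e _ => e.1) (fun j _ => (j, i)) ?_ ?_ ?_ ?_ ?_ <;>
    simp +contextual [Prod.forall]
  all_goals rintro a b h rfl; simp [h]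

theorem input_edgeList (hε : 0 < ε) (hε1 : ε ≤ 1) (hp : ∀ j i, (j, i) ∈ E → 0 < p i j)
    (hx : IsFractionalAssignment E x) :
    EdgeList n E.card ((input E edge p x ε).nat 1) ((input E edge p x ε).nat 2)
      ((input E edge p x ε).real 1) ((input E edge p x ε).real 2) ε := by
  refine ⟨hε, hε1, fun e he => ?_, fun e he f hf h1 h2 => ?_, fun e he => ?_, fun e he => ?_,
    fun j hj => ?_⟩
  · rw [input_job E edge p x ε ⟨e, he⟩]; exact (edge ⟨e, he⟩).1.1.2
  · rw [input_job E edge p x ε ⟨e, he⟩, input_job E edge p x ε ⟨f, hf⟩] at h1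
    rw [input_mc E edge p x ε ⟨e, he⟩, input_mc E edge p x ε ⟨f, hf⟩] at h2
    have := edge.injective (Subtype.ext (Prod.ext (Fin.ext h1) (Fin.ext h2)))
    simpa using this
  · rw [input_time E edge p x ε ⟨e, he⟩]; exact hp _ _ (edge ⟨e, he⟩).2
  · rw [input_frac E edge p x ε ⟨e, he⟩]; exact hx.1 _ _ (edge ⟨e, he⟩).2
  · rw [sum_edges E edge _ _ (fun e => x e.1 e.2) (fun e => e.1 = ⟨j, hj⟩)
      (fun k => by rw [input_job, Fin.ext_iff]) (input_frac E edge p x ε),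
      sum_edges_of_job E _ ⟨j, hj⟩]
    exact hx.2 ⟨j, hj⟩

theorem input_holdsInstance :
    HoldsInstance n E.card ((input E edge p x ε).nat 1) ((input E edge p x ε).nat 2)
      ((input E edge p x ε).real 1) ((input E edge p x ε).real 2) ε (input E edge p x ε) :=
  ⟨by simp [input], by simp [input], rfl, rfl, by simp [input], rfl, rfl⟩

theorem input_nat_eq_zero (a : ℕ) (ha : 3 ≤ a) (k : ℕ) : (input E edge p x ε).nat a k = 0 := by
  obtain ⟨b, rfl⟩ : ∃ b, a = b + 3 := ⟨a - 3, by omega⟩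
  simp [input]

end

end UnrelatedMachines

theorem mainTheorem6 :
    ∃ (P : RealRAM.Program) (C : ℝ),
      ∀ (n m : ℕ) (E : Finset (Fin n × Fin m)) (edge : Fin E.card ≃ {e // e ∈ E})
        (p : Fin m → Fin n → ℝ) (x : Fin n → Fin m → ℝ) (ε : ℝ),
        0 < n → 0 < ε → ε ≤ 1 →
        (∀ j i, (j, i) ∈ E → 0 < p i j) →
        UnrelatedMachines.IsFractionalAssignment E x →
        ∃ (t : ℕ) (s : RealRAM.Memory) (σ : Fin n → Fin m),
          RealRAM.Runs P (UnrelatedMachines.input E edge p x ε) t s ∧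
          (t : ℝ) ≤ C * ((E.card : ℝ) / ε * Real.log ((n : ℝ) + 1)) ∧
          UnrelatedMachines.IsOutput s σ ∧
          (∀ j, (j, σ j) ∈ E ∧ 0 < x j (σ j)) ∧
          ∀ i, UnrelatedMachines.load p σ i ≤
            UnrelatedMachines.maxJob p σ i +
              (1 + ε) * UnrelatedMachines.fractionalLoad E p x i := by
  refine ⟨UnrelatedMachines.roundingProgram, 100000, ?_⟩
  intro n m E edge p x ε hn hε hε1 hp hx
  obtain ⟨K, L, hK, hL, hKL⟩ := UnrelatedMachines.exists_exponents hn hε hε1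
  obtain ⟨t, s, hruns, ht, f, hf, hload⟩ := UnrelatedMachines.roundingProgram_ends
    (UnrelatedMachines.input_edgeList E edge p x ε hε hε1 hp hx)
    (UnrelatedMachines.input_holdsInstance E edge p x ε)
    (UnrelatedMachines.input_nat_eq_zero E edge p x ε) hn hK hL
  set g : Fin n → Fin E.card := fun j => ⟨f j, (hf j j.2).1⟩ with hg
  have hfst : ∀ j, (edge (g j)).1.1 = j := fun j => by
    have := (hf j j.2).2.1
    exact Fin.ext ((UnrelatedMachines.input_job E edge p x ε (g j)).symm.trans this)
  have hmc : ∀ j : Fin n, (UnrelatedMachines.input E edge p x ε).nat 2 (f j) =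
      ((edge (g j)).1.2 : ℕ) := fun j => UnrelatedMachines.input_mc E edge p x ε (g j)
  have htime : ∀ j : Fin n, (UnrelatedMachines.input E edge p x ε).real 1 (f j) =
      p (edge (g j)).1.2 j := fun j => by
    rw [show f j = (g j : ℕ) from rfl, UnrelatedMachines.input_time, hfst]
  refine ⟨t, s, fun j => (edge (g j)).1.2, hruns, ?_, fun j => ?_, fun j => ⟨?_, ?_⟩, fun i => ?_⟩
  · calc (t : ℝ) ≤ ((E.card * (12000 * (K + 1) + 1200 * (L + 1)) : ℕ) : ℝ) := by exact_mod_cast ht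
      _ = E.card * (12000 * ((K : ℝ) + 1) + 1200 * ((L : ℝ) + 1)) := by push_cast; ring
      _ ≤ E.card * (100000 * (Real.log ((n : ℝ) + 1) / ε)) := by gcongr
      _ = 100000 * ((E.card : ℝ) / ε * Real.log ((n : ℝ) + 1)) := by ring
  · rw [(hf j j.2).2.2.2, hmc]
  · have := (edge (g j)).2
    rwa [show (edge (g j)).1 = (j, (edge (g j)).1.2) from Prod.ext (hfst j) rfl] at this
  · have := (hf j j.2).2.2.1
    rwa [show f j = (g j : ℕ) from rfl, UnrelatedMachines.input_frac, hfst] at this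
  · set σ : Fin n → Fin m := fun j => (edge (g j)).1.2 with hσ
    have hmax : ∀ j, σ j = i → p i j ≤ UnrelatedMachines.maxJob p σ i := by
      intro j hj
      have hmem : j ∈ UnrelatedMachines.jobsOn σ i := Finset.mem_filter.2 ⟨Finset.mem_univ _, hj⟩
      rw [UnrelatedMachines.maxJob, dif_pos ⟨j, hmem⟩]
      exact Finset.le_sup' (p i) hmem
    -- The load bound requires `0 ≤ M`, since the first slot of a machine may remain unoccupied;
    -- positivity of the processing times and the default value 0 provide it.
    have hmax0 : 0 ≤ UnrelatedMachines.maxJob p σ i := by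
      by_cases hne : (UnrelatedMachines.jobsOn σ i).Nonempty
      · obtain ⟨j, hj⟩ := hne
        have hj := (Finset.mem_filter.1 hj).2
        refine le_trans (le_of_lt ?_) (hmax j hj)
        have := hp _ _ (edge (g j)).2
        rwa [hfst, show (edge (g j)).1.2 = i from hj] at this
      · rw [UnrelatedMachines.maxJob, dif_neg hne]
    have key := hload i _ hmax0 fun j hj hji => by
      have h1 := hmc ⟨j, hj⟩
      have h2 : σ ⟨j, hj⟩ = i := Fin.ext (h1.symm.trans hji)
      have h3 := htime ⟨j, hj⟩
      rw [show (edge (g ⟨j, hj⟩)).1.2 = i from h2] at h3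
      exact h3.le.trans (hmax _ h2)
    convert key using 1
    · rw [UnrelatedMachines.load, UnrelatedMachines.jobsOn, Finset.sum_filter, Finset.sum_filter,
        Finset.sum_range]
      refine Finset.sum_congr rfl fun j _ => ?_
      rw [hmc, htime]
      by_cases hj : σ j = i
      · rw [if_pos hj, if_pos (congrArg Fin.val hj), show (edge (g j)).1.2 = i from hj]
      · rw [if_neg hj, if_neg fun hc => hj (Fin.ext hc)]
    · rw [UnrelatedMachines.sum_edges E edge _ _ (fun e => p e.2 e.1 * x e.1 e.2) (fun e => e.2 = i)
        (fun k => by rw [UnrelatedMachines.input_mc, Fin.ext_iff])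
        (fun k => by rw [UnrelatedMachines.input_time, UnrelatedMachines.input_frac]),
        UnrelatedMachines.sum_edges_of_machine]
      rfl
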